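/- Let $Q$ be a smooth (finite-dimensional, Hausdorff, boundaryless) manifold and let $(E,[\![\cdot,\cdot]\!],\rho)$ be a Lie algebroid on a vector bundle $\tau_E:E\to Q$. Consider a mechanical system with affine nonholonomic constraints on $E$: a vector subbundle $\tau_U:U\to Q$ of $E$, a (positive definite) bundle metric $\mathcal G$ on $E$, a function $\mathbb V\in C^\infty(Q)$, and a section $X_0\in\Gamma(E)$ with $\mathcal P(X_0)=0$, where $\mathcal P:E=U\oplus U^\perp\to U$ is the orthogonal projector. Let $\mathcal U_q=X_0(q)+U_q$ be the constraint affine bundle, $\mathcal U^+$ the bundle of affine functions on the fibres of $\mathcal U$, and $\widetilde{\mathcal U}=(\mathcal U^+)^*$ its bidual, identified with the vector subbundle of $\mathbb R\times E$ with fibres $$\widetilde{\mathcal U}_q=\{(\lambda,\lambda X_0(q)+u)\;:\;\lambda\in\mathbb R,\ u\in U_q\}.$$ Let $\widetilde{\mathcal P}:\mathbb R\times E\to\widetilde{\mathcal U}$, $\widetilde{\mathcal P}(\lambda,e)=(\lambda,\lambda X_0+\mathcal P(e))$. The bundle $\mathbb R\times E$ carries the Lie algebroid structure $$[\![(f,\sigma),(g,\gamma)]\!]_{\mathbb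 R\times E}=(\rho(\sigma)(g)-\rho(\gamma)(f),[\![\sigma,\gamma]\!]),\qquad \rho_{\mathbb R\times E}(f,\sigma)=\rho(\sigma).$$ Endow $\widetilde{\mathcal U}$ with the skew-symmetric algebroid structure $[\![s,t]\!]_{\widetilde{\mathcal U}}=\widetilde{\mathcal P}[\![s,t]\!]_{\mathbb R\times E}$, $\rho_{\widetilde{\mathcal U}}=\rho_{\mathbb R\times E}|_{\widetilde{\mathcal U}}$, and $U$ with $[\![\sigma,\gamma]\!]_U=\mathcal P[\![\sigma,\gamma]\!]$, $\rho_U=\rho|_U$. For a skew-symmetric algebroid $(A,[\![\cdot,\cdot]\!]_A,\rho_A)$ and $\beta\in\Gamma(A^*)$ put $$(d^A\beta)(\sigma,\gamma)=\rho_A(\sigma)(\beta(\gamma))-\rho_A(\gamma)(\beta(\sigma))-\beta([\![\sigma,\gamma]\!]_A).$$ Let $\phi\in\Gamma(\mathcal U^+)$ be the section $\phi(\lambda,\lambda X_0+u)=\lambda$ and let $\mu:\mathcal U^+\to U^*$ be the dual of the inclusion $U\to\widetilde{\mathcal U}$, $u\mapsto(0,u)$. Define $H:U^*\to\mathbb R$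 by $H(\eta)=\tfrac12\mathcal G_{U^*}(\eta,\eta)+\mathbb V(\tau_{U^*}(\eta))$, where $\mathcal G_{U^*}$ is the fibre metric on $U^*$ induced by $\mathcal G$; let $h:U^*\to\mathcal U^+$ be the section of $\mu$ given by $h(\eta)(\lambda,\lambda X_0+u)=\eta(u)-\lambda H(\eta)$, and let $F_h:\mathcal U^+\to\mathbb R$ be determined by $\xi-h(\mu(\xi))=F_h(\xi)\,\phi$. Then there is a unique field $\Pi$ of skew-symmetric bilinear forms on the cotangent spaces of $\mathcal U^+$ (a bivector field, not assumed smooth) whose bracket $\{F,G\}=\Pi(dF,dG)$ satisfies, for all $s,t\in\Gamma(\widetilde{\mathcal U})$ and $f,g\in C^\infty(Q)$, $$\{\widehat s,\widehat t\,\}=-\widehat{[\![s,t]\!]_{\widetilde{\mathcal U}}},\qquad \{f\circ\tau,\widehat s\,\}=\rho_{\widetilde{\mathcal U}}(s)(f)\circ\tau,\qquad \{f\circ\tau,g\circ\tau\}=0,$$ where $\tau:\mathcal U^+\to Q$ is the projection and $\widehat s$ is the function on $\mathcal U^+$ that is linear on fibres and is given by $s$; and there is a unique vector field $R_h$ on $U^*$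 (not assumed smooth) with $R_h(G)\circ\mu=\{G\circ\mu,F_h\}$ for all $G\in C^\infty(U^*)$. The integral curves of $R_h$ are called the solutions of the Hamilton equations. Let $\alpha\in\Gamma(U^*)$, let $R_h^\alpha=T\tau_{U^*}\circ R_h\circ\alpha$, a vector field on $Q$, and let $\zeta_H^\alpha\in\Gamma(U)$ be the section with $\eta(\zeta_H^\alpha)=\frac{d}{dt}\big|_{t=0}H(\alpha+t\eta)$ for all $\eta\in\Gamma(U^*)$. The following statements are equivalent: (i) for every integral curve $c:J\to Q$ of $R_h^\alpha$ on an open interval $J$, the curve $\alpha\circ c:J\to U^*$ is a solution of the Hamilton equations; (ii) $\alpha$ satisfies the Hamilton–Jacobi equation $$i_{\zeta_H^\alpha}\,d^U\alpha+\mu\circ i_{(1,X_0)}\,d^{\widetilde{\mathcal U}}(h\circ\alpha)=0,$$ where $\mu$ acts on sections of $\widetilde{\mathcal U}^*=\mathcal U^+$. -/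

import Mathlib

open Bundle
open scoped Manifold ContDiff Bundle

set_option linter.unusedSectionVars false

noncomputable section

namespace AffineHJ

/-- The family of dual spaces `E* = (q ↦ (E q)*)` of a family of vector spaces `E`. -/
abbrev CoFiber {Q : Type*} (E : Q → Type*) [∀ q, TopologicalSpace (E q)]
    [∀ q, AddCommGroup (E q)] [∀ q, Module ℝ (E q)] : Q → Type _ :=
  fun q => E q →L[ℝ] ℝ

/-- The total space of the dual bundle `E* → Q`. -/
abbrev CoTotal {Q : Type*} (F : Type*) [NormedAddCommGroup F] [NormedSpace ℝ F]
    (E : Q → Type*) [∀ q, TopologicalSpace (E q)]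
    [∀ q, AddCommGroup (E q)] [∀ q, Module ℝ (E q)] : Type _ :=
  TotalSpace (F →L[ℝ] ℝ) (CoFiber E)

section Smoothness

variable {EQ : Type*} [NormedAddCommGroup EQ] [NormedSpace ℝ EQ]
  {HQ : Type*} [TopologicalSpace HQ] {I : ModelWithCorners ℝ EQ HQ}
  {Q : Type*} [TopologicalSpace Q] [ChartedSpace HQ Q]
  {F : Type*} [NormedAddCommGroup F] [NormedSpace ℝ F]
  {E : Q → Type*} [TopologicalSpace (TotalSpace F E)] [∀ q, TopologicalSpace (E q)]
  [∀ q, AddCommGroup (E q)] [∀ q, Module ℝ (E q)] [FiberBundle F E] [VectorBundle ℝ F E]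
  {F' : Type*} [NormedAddCommGroup F'] [NormedSpace ℝ F']
  {E' : Q → Type*} [TopologicalSpace (TotalSpace F' E')] [∀ q, TopologicalSpace (E' q)]
  [∀ q, AddCommGroup (E' q)] [∀ q, Module ℝ (E' q)] [FiberBundle F' E'] [VectorBundle ℝ F' E']

theorem contMDiffAt_clm_of_apply [FiniteDimensional ℝ F] {f : Q → F →L[ℝ] F'} {q₀ : Q}
    (h : ∀ v, ContMDiffAt I 𝓘(ℝ, F') ∞ (fun q => f q v) q₀) :
    ContMDiffAt I 𝓘(ℝ, F →L[ℝ] F') ∞ f q₀ := by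
  let b := Module.finBasis ℝ F
  let c : ∀ i, F →L[ℝ] ℝ := fun i => LinearMap.toContinuousLinearMap (b.coord i)
  have hf : f = fun q => ∑ i, ContinuousLinearMap.smulRightL ℝ F F' (c i) (f q (b i)) := by
    funext q
    ext v
    calc f q v = f q (∑ i, b.repr v i • b i) := by rw [b.sum_repr]
      _ = _ := by
        rw [map_sum]
        simp [c]
  rw [hf]
  refine ContMDiffAt.sum fun i _ => ?_
  exact (ContinuousLinearMap.contMDiff (n := ∞)
    (ContinuousLinearMap.smulRightL ℝ F F' (c i))).contMDiffAt.comp q₀ (h (b i))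

/-- A fibrewise linear map that sends local smooth sections to local smooth sections is a smooth
section of the bundle of homomorphisms. -/
theorem contMDiffAt_hom_of_sections [FiniteDimensional ℝ F]
    [∀ q, IsTopologicalAddGroup (E q)] [∀ q, ContinuousSMul ℝ (E q)]
    [∀ q, IsTopologicalAddGroup (E' q)] [∀ q, ContinuousSMul ℝ (E' q)]
    [ContMDiffVectorBundle ∞ F E I]
    {φ : ∀ q, E q →L[ℝ] E' q}
    {q₀ : Q} (h : ∀ σ : ∀ q, E q,
      ContMDiffAt I (I.prod 𝓘(ℝ, F)) ∞ (fun q => TotalSpace.mk' F q (σ q)) q₀ →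
      ContMDiffAt I (I.prod 𝓘(ℝ, F')) ∞ (fun q => TotalSpace.mk' F' q (φ q (σ q))) q₀) :
    ContMDiffAt I (I.prod 𝓘(ℝ, F →L[ℝ] F')) ∞
      (fun q => TotalSpace.mk' (F →L[ℝ] F') (E := fun q => E q →L[ℝ] E' q) q (φ q)) q₀ := by
  rw [contMDiffAt_hom_bundle]
  refine ⟨contMDiffAt_id, ?_⟩
  refine contMDiffAt_clm_of_apply fun v => ?_
  have hσ : ContMDiffAt I (I.prod 𝓘(ℝ, F)) ∞
      (fun q => TotalSpace.mk' F q ((trivializationAt F E q₀).symmL ℝ q v)) q₀ :=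
    ((trivializationAt F E q₀).contMDiffAt_symmL (n := ∞) (IB := I)
      (FiberBundle.mem_baseSet_trivializationAt' q₀)).clm_bundle_apply
      (F₁ := F) (E₁ := Trivial Q F) (b := fun q => q) (v := fun _ => v)
      (by
        rw [contMDiffAt_section]
        exact contMDiffAt_const)
  have h1 := h _ hσ
  rw [contMDiffAt_section] at h1
  refine h1.congr_of_eventuallyEq ?_
  filter_upwards [(trivializationAt F' E' q₀).open_baseSet.mem_nhds
    (FiberBundle.mem_baseSet_trivializationAt' q₀)] with q hq
  simp [ContinuousLinearMap.inCoordinates, Trivialization.coe_linearMapAt_of_mem _ hq]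

theorem contMDiff_hom_of_sections [FiniteDimensional ℝ F]
    [∀ q, IsTopologicalAddGroup (E q)] [∀ q, ContinuousSMul ℝ (E q)]
    [∀ q, IsTopologicalAddGroup (E' q)] [∀ q, ContinuousSMul ℝ (E' q)]
    [ContMDiffVectorBundle ∞ F E I]
    {φ : ∀ q, E q →L[ℝ] E' q}
    (h : ∀ q₀, ∀ σ : ∀ q, E q,
      ContMDiffAt I (I.prod 𝓘(ℝ, F)) ∞ (fun q => TotalSpace.mk' F q (σ q)) q₀ →
      ContMDiffAt I (I.prod 𝓘(ℝ, F')) ∞ (fun q => TotalSpace.mk' F' q (φ q (σ q))) q₀) :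
    ContMDiff I (I.prod 𝓘(ℝ, F →L[ℝ] F')) ∞
      (fun q => TotalSpace.mk' (F →L[ℝ] F') (E := fun q => E q →L[ℝ] E' q) q (φ q)) :=
  fun q₀ => contMDiffAt_hom_of_sections (h q₀)

/-- The fibrewise inverse of a smooth fibrewise invertible bundle map is smooth. -/
theorem contMDiff_hom_inverse [CompleteSpace F]
    [∀ q, IsTopologicalAddGroup (E q)] [∀ q, ContinuousSMul ℝ (E q)]
    [∀ q, IsTopologicalAddGroup (E' q)] [∀ q, ContinuousSMul ℝ (E' q)]
    {φ : ∀ q, E q →L[ℝ] E' q}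
    (h : ContMDiff I (I.prod 𝓘(ℝ, F →L[ℝ] F')) ∞
      (fun q => TotalSpace.mk' (F →L[ℝ] F') (E := fun q => E q →L[ℝ] E' q) q (φ q)))
    (hinv : ∀ q, (φ q).IsInvertible) :
    ContMDiff I (I.prod 𝓘(ℝ, F' →L[ℝ] F)) ∞
      (fun q => TotalSpace.mk' (F' →L[ℝ] F) (E := fun q => E' q →L[ℝ] E q) q (φ q).inverse) := by
  intro q₀
  have h0 := h q₀
  rw [contMDiffAt_hom_bundle] at h0 ⊢
  refine ⟨contMDiffAt_id, ?_⟩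
  have hE := FiberBundle.mem_baseSet_trivializationAt F E q₀
  have hE' := FiberBundle.mem_baseSet_trivializationAt F' E' q₀
  have h2 : ContMDiffAt I 𝓘(ℝ, F' →L[ℝ] F) ∞
      (ContinuousLinearMap.inverse ∘ fun q =>
        ContinuousLinearMap.inCoordinates F E F' E' q₀ q q₀ q (φ q)) q₀ := by
    refine ContMDiffAt.comp q₀ ?_ h0.2
    apply ContDiffAt.contMDiffAt
    apply ContinuousLinearMap.IsInvertible.contDiffAt_map_inverse
    rw [ContinuousLinearMap.inCoordinates_eq hE hE']
    exact ContinuousLinearMap.isInvertible_equiv.comp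
      ((hinv q₀).comp ContinuousLinearMap.isInvertible_equiv)
  refine h2.congr_of_eventuallyEq ?_
  filter_upwards [(trivializationAt F E q₀).open_baseSet.mem_nhds hE,
    (trivializationAt F' E' q₀).open_baseSet.mem_nhds hE'] with q hq hq'
  simp only [Function.comp_apply]
  rw [ContinuousLinearMap.inCoordinates_eq hq hq', ContinuousLinearMap.inCoordinates_eq hq' hq]
  simp [ContinuousLinearMap.comp_assoc]

/-- The composition of smooth vector bundle morphisms is smooth. -/
theorem contMDiff_hom_comp
    {F'' : Type*} [NormedAddCommGroup F''] [NormedSpace ℝ F'']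
    {E'' : Q → Type*} [TopologicalSpace (TotalSpace F'' E'')] [∀ q, TopologicalSpace (E'' q)]
    [∀ q, AddCommGroup (E'' q)] [∀ q, Module ℝ (E'' q)] [FiberBundle F'' E'']
    [VectorBundle ℝ F'' E'']
    [∀ q, IsTopologicalAddGroup (E' q)] [∀ q, ContinuousSMul ℝ (E' q)]
    [∀ q, IsTopologicalAddGroup (E'' q)] [∀ q, ContinuousSMul ℝ (E'' q)]
    {φ : ∀ q, E q →L[ℝ] E' q} {ψ : ∀ q, E' q →L[ℝ] E'' q}
    (hφ : ContMDiff I (I.prod 𝓘(ℝ, F →L[ℝ] F')) ∞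
      (fun q => TotalSpace.mk' (F →L[ℝ] F') (E := fun q => E q →L[ℝ] E' q) q (φ q)))
    (hψ : ContMDiff I (I.prod 𝓘(ℝ, F' →L[ℝ] F'')) ∞
      (fun q => TotalSpace.mk' (F' →L[ℝ] F'') (E := fun q => E' q →L[ℝ] E'' q) q (ψ q))) :
    ContMDiff I (I.prod 𝓘(ℝ, F →L[ℝ] F'')) ∞
      (fun q => TotalSpace.mk' (F →L[ℝ] F'') (E := fun q => E q →L[ℝ] E'' q) q
        ((ψ q).comp (φ q))) := by
  intro q₀
  have h1 := hφ q₀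
  have h2 := hψ q₀
  rw [contMDiffAt_hom_bundle] at h1 h2 ⊢
  refine ⟨contMDiffAt_id, (h2.2.clm_comp h1.2).congr_of_eventuallyEq ?_⟩
  filter_upwards [(trivializationAt F E q₀).open_baseSet.mem_nhds
      (FiberBundle.mem_baseSet_trivializationAt F E q₀),
    (trivializationAt F' E' q₀).open_baseSet.mem_nhds
      (FiberBundle.mem_baseSet_trivializationAt F' E' q₀),
    (trivializationAt F'' E'' q₀).open_baseSet.mem_nhds
      (FiberBundle.mem_baseSet_trivializationAt F'' E'' q₀)] with q hq hq' hq''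
  rw [ContinuousLinearMap.inCoordinates_eq hq hq', ContinuousLinearMap.inCoordinates_eq hq' hq'',
    ContinuousLinearMap.inCoordinates_eq hq hq'']
  ext v
  simp [Trivialization.symm_apply_apply_mk _ hq']

/-- A local section of `ℝ × E` is smooth if and only if both of its components are. -/
theorem contMDiffAt_prod_section {f : Q → ℝ} {σ : ∀ q, E q} {q₀ : Q} :
    ContMDiffAt I (I.prod 𝓘(ℝ, ℝ × F)) ∞
      (fun q => TotalSpace.mk' (ℝ × F) (E := Trivial Q ℝ ×ᵇ E) q (f q, σ q)) q₀ ↔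
    ContMDiffAt I 𝓘(ℝ, ℝ) ∞ f q₀ ∧
      ContMDiffAt I (I.prod 𝓘(ℝ, F)) ∞ (fun q => TotalSpace.mk' F q (σ q)) q₀ := by
  rw [contMDiffAt_section, contMDiffAt_section]
  have : (fun q => ((trivializationAt (ℝ × F) (Trivial Q ℝ ×ᵇ E) q₀)
      (TotalSpace.mk' (ℝ × F) (E := Trivial Q ℝ ×ᵇ E) q (f q, σ q))).2) =
      fun q => (f q, ((trivializationAt F E q₀) (TotalSpace.mk' F q (σ q))).2) := rfl
  rw [this, contMDiffAt_prod_module_iff]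
  rfl

end Smoothness

section Algebroids

variable {EQ : Type*} [NormedAddCommGroup EQ] [NormedSpace ℝ EQ]
  {HQ : Type*} [TopologicalSpace HQ] (I : ModelWithCorners ℝ EQ HQ)
  {Q : Type*} [TopologicalSpace Q] [ChartedSpace HQ Q]
  (F : Type*) [NormedAddCommGroup F] [NormedSpace ℝ F]
  (E : Q → Type*) [TopologicalSpace (TotalSpace F E)] [∀ q, TopologicalSpace (E q)]
  [∀ q, AddCommGroup (E q)] [∀ q, Module ℝ (E q)] [FiberBundle F E] [VectorBundle ℝ F E]
  (F' : Type*) [NormedAddCommGroup F'] [NormedSpace ℝ F']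
  (E' : Q → Type*) [TopologicalSpace (TotalSpace F' E')] [∀ q, TopologicalSpace (E' q)]
  [∀ q, AddCommGroup (E' q)] [∀ q, Module ℝ (E' q)] [FiberBundle F' E'] [VectorBundle ℝ F' E']
  [∀ q, IsTopologicalAddGroup (E' q)] [∀ q, ContinuousSMul ℝ (E' q)]

/-- Smooth vector bundle morphisms `E → E'` over the identity of `Q`. -/
abbrev BundleHom : Type _ := Cₛ^∞⟮I; F →L[ℝ] F', fun q => E q →L[ℝ] E' q⟯

variable {I F E F' E'}

/-- The action `Γ(E) → Γ(E')` of a vector bundle morphism on smooth sections. -/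
def mapSec (φ : BundleHom I F E F' E') (σ : Cₛ^∞⟮I; F, E⟯) : Cₛ^∞⟮I; F', E'⟯ :=
  ⟨fun q => φ q (σ q), φ.contMDiff.clm_bundle_apply σ.contMDiff⟩

/-- The product `f σ` of a smooth function and a smooth section. -/
def funSmul (f : C^∞⟮I, Q; 𝓘(ℝ, ℝ), ℝ⟯) (σ : Cₛ^∞⟮I; F, E⟯) : Cₛ^∞⟮I; F, E⟯ :=
  ⟨fun q => f q • σ q, f.contMDiff.smul_section σ.contMDiff⟩

/-- The differential at `x` of a real function on a manifold. -/
def dif {EN : Type*} [NormedAddCommGroup EN] [NormedSpace ℝ EN] {HN : Type*} [TopologicalSpace HN]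
    (J : ModelWithCorners ℝ EN HN) {N : Type*} [TopologicalSpace N] [ChartedSpace HN N]
    (f : N → ℝ) (x : N) : TangentSpace J x →L[ℝ] ℝ :=
  mfderiv J 𝓘(ℝ, ℝ) f x

variable [IsManifold I ∞ Q]

/-- The function `ρ(σ)(f)`, for an anchor `ρ : E → TQ`, a section `σ` of `E` and a function `f`. -/
def anchorDeriv (ρ : BundleHom I F E EQ (TangentSpace I)) (σ : Cₛ^∞⟮I; F, E⟯) (f : Q → ℝ) :
    Q → ℝ :=
  fun q => dif I f q (ρ q (σ q))

theorem contMDiff_anchorDeriv (ρ : BundleHom I F E EQ (TangentSpace I)) (σ : Cₛ^∞⟮I; F, E⟯)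
    (f : C^∞⟮I, Q; 𝓘(ℝ, ℝ), ℝ⟯) :
    ContMDiff I 𝓘(ℝ, ℝ) ∞ (anchorDeriv ρ σ f) := by
  have h1 := f.contMDiff.contMDiff_tangentMap (m := ∞) (by simp)
  have h2 := h1.comp (mapSec ρ σ).contMDiff
  intro q
  have h3 := (contMDiffAt_totalSpace.1 (h2 q)).2
  have h4 : ContMDiffAt I 𝓘(ℝ, ℝ) ∞ (fun q => mfderiv I 𝓘(ℝ, ℝ) f q (ρ q (σ q))) q := by
    simpa [tangentMap, mapSec] using h3
  exact h4

variable (I F E)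

/-- A skew-symmetric algebroid structure on the vector bundle `E → Q`. -/
structure SkewAlgebroid where
  /-- the bracket of sections -/
  bracket : Cₛ^∞⟮I; F, E⟯ →ₗ[ℝ] Cₛ^∞⟮I; F, E⟯ →ₗ[ℝ] Cₛ^∞⟮I; F, E⟯
  /-- the anchor map `E → TQ` -/
  anchor : BundleHom I F E EQ (TangentSpace I)
  skew : ∀ σ γ, bracket σ γ = -bracket γ σ
  leibniz : ∀ (σ γ : Cₛ^∞⟮I; F, E⟯) (f : C^∞⟮I, Q; 𝓘(ℝ, ℝ), ℝ⟯) (q : Q),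
    bracket σ (funSmul f γ) q = f q • bracket σ γ q + anchorDeriv anchor σ f q • γ q

/-- A Lie algebroid structure on `E → Q`: the bracket satisfies in addition the Jacobi identity. -/
structure LieAlgebroid extends SkewAlgebroid I F E where
  jacobi : ∀ σ γ δ, bracket σ (bracket γ δ) + bracket γ (bracket δ σ) + bracket δ (bracket σ γ) = 0

variable {I F E}

/-- The almost differential of a section `β` of `E*`, as a function of two sections of `E`:
`(dβ)(σ, γ) = ρ(σ)(β(γ)) - ρ(γ)(β(σ)) - β([σ, γ])`. -/
def SkewAlgebroid.almostDiff (A : SkewAlgebroid I F E) (β : ∀ q, CoFiber E q)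
    (σ γ : Cₛ^∞⟮I; F, E⟯) : Q → ℝ :=
  anchorDeriv A.anchor σ (fun q => β q (γ q)) - anchorDeriv A.anchor γ (fun q => β q (σ q))
    - fun q => β q (A.bracket σ γ q)

/-- The contraction `i_ζ θ` of a `2`-form `θ` on `E`. Forms are written as functions
of sections. -/
def contract (ζ : Cₛ^∞⟮I; F, E⟯) (θ : Cₛ^∞⟮I; F, E⟯ → Cₛ^∞⟮I; F, E⟯ → Q → ℝ) :
    Cₛ^∞⟮I; F, E⟯ → Q → ℝ :=
  θ ζ

/-- The pull-back of a `1`-form on `E'` by a vector bundle morphism `E → E'`. -/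
def pullForm (φ : BundleHom I F E F' E') (θ : Cₛ^∞⟮I; F', E'⟯ → Q → ℝ) :
    Cₛ^∞⟮I; F, E⟯ → Q → ℝ :=
  fun σ => θ (mapSec φ σ)

/-- The skew-symmetric algebroid induced on `E` by a skew-symmetric algebroid on `E'`, a vector
bundle monomorphism `i : E → E'` and a projector `P : E' → E`, so that `P ∘ i = id`:
the bracket is `P [i σ, i γ]` and the anchor is `ρ ∘ i`. -/
def SkewAlgebroid.project [∀ q, IsTopologicalAddGroup (E q)] [∀ q, ContinuousSMul ℝ (E q)]
    (A : SkewAlgebroid I F' E') (i : BundleHom I F E F' E') (P : BundleHom I F' E' F E)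
    (hP : ∀ q v, P q (i q v) = v) : SkewAlgebroid I F E where
  bracket := LinearMap.mk₂ ℝ (fun σ γ => mapSec P (A.bracket (mapSec i σ) (mapSec i γ)))
    (fun σ σ' γ => by
      have : mapSec i (σ + σ') = mapSec i σ + mapSec i σ' := by ext q; simp [mapSec]
      ext q; simp [this]; simp [mapSec])
    (fun c σ γ => by
      have : mapSec i (c • σ) = c • mapSec i σ := by ext q; simp [mapSec]
      ext q; simp [this]; simp [mapSec])
    (fun σ γ γ' => by
      have : mapSec i (γ + γ') = mapSec i γ + mapSec i γ' := by ext q; simp [mapSec]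
      ext q; simp [this]; simp [mapSec])
    (fun c σ γ => by
      have : mapSec i (c • γ) = c • mapSec i γ := by ext q; simp [mapSec]
      ext q; simp [this]; simp [mapSec])
  anchor := ⟨fun q => (A.anchor q).comp (i q), contMDiff_hom_comp i.contMDiff A.anchor.contMDiff⟩
  skew σ γ := by
    ext q
    simp only [LinearMap.mk₂_apply]
    rw [A.skew]
    simp [mapSec]
  leibniz σ γ f q := by
    have h1 : mapSec i (funSmul f γ) = funSmul f (mapSec i γ) := by
      ext q; simp [mapSec, funSmul]
    simp only [LinearMap.mk₂_apply]
    rw [h1]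
    have h2 := A.leibniz (mapSec i σ) (mapSec i γ) f q
    change P q (A.bracket (mapSec i σ) (funSmul f (mapSec i γ)) q) = _
    rw [h2, map_add, map_smul, map_smul]
    change _ + _ • P q (i q (γ q)) = _
    rw [hP]
    rfl

/-- The linear function `σ̂ : E* → ℝ` of a section `σ` of `E`. -/
def linFun (σ : Cₛ^∞⟮I; F, E⟯) : CoTotal F E → ℝ :=
  fun ξ => ξ.2 (σ ξ.1)

/-- The type of fields of bilinear forms on the cotangent spaces of the manifold `E*`, that is, of
contravariant `2`-tensor fields on `E*`. -/
abbrev BivectorField (I : ModelWithCorners ℝ EQ HQ) (F : Type*) [NormedAddCommGroup F]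
    [NormedSpace ℝ F] (E : Q → Type*) [TopologicalSpace (TotalSpace F E)]
    [∀ q, TopologicalSpace (E q)] [∀ q, AddCommGroup (E q)] [∀ q, Module ℝ (E q)]
    [FiberBundle F E] [VectorBundle ℝ F E] : Type _ :=
  ∀ ξ : CoTotal F E,
    (TangentSpace (I.prod 𝓘(ℝ, F →L[ℝ] ℝ)) ξ →L[ℝ] ℝ) →ₗ[ℝ]
      (TangentSpace (I.prod 𝓘(ℝ, F →L[ℝ] ℝ)) ξ →L[ℝ] ℝ) →ₗ[ℝ] ℝ

/-- The bracket `{G, K} = Π(dG, dK)` of functions on `E*` given by a bivector field `Π`. -/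
def BivectorField.poisson (B : BivectorField I F E) (G K : CoTotal F E → ℝ) :
    CoTotal F E → ℝ :=
  fun ξ => B ξ (dif (I.prod 𝓘(ℝ, F →L[ℝ] ℝ)) G ξ) (dif (I.prod 𝓘(ℝ, F →L[ℝ] ℝ)) K ξ)

/-- `B` is the linear almost Poisson bivector on `E*` of the skew-symmetric algebroid `A`: it is
skew-symmetric and its bracket satisfies `{σ̂, γ̂} = -[σ, γ]^`, `{f ∘ τ, σ̂} = ρ(σ)(f) ∘ τ` and
`{f ∘ τ, g ∘ τ} = 0`, where `τ : E* → Q` is the projection. -/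
structure SkewAlgebroid.IsLinearPoisson (A : SkewAlgebroid I F E) (B : BivectorField I F E) :
    Prop where
  skew : ∀ ξ η θ, B ξ η θ = -B ξ θ η
  lin_lin : ∀ σ γ : Cₛ^∞⟮I; F, E⟯,
    B.poisson (linFun σ) (linFun γ) = -linFun (A.bracket σ γ)
  base_lin : ∀ (f : C^∞⟮I, Q; 𝓘(ℝ, ℝ), ℝ⟯) (σ : Cₛ^∞⟮I; F, E⟯),
    B.poisson (fun ξ => f ξ.1) (linFun σ) = fun ξ => anchorDeriv A.anchor σ f ξ.1
  base_base : ∀ f g : C^∞⟮I, Q; 𝓘(ℝ, ℝ), ℝ⟯,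
    B.poisson (fun ξ => f ξ.1) (fun ξ => g ξ.1) = 0

/-- The linear almost Poisson bivector on `E*` of a skew-symmetric algebroid on `E`,
by definite description. -/
def SkewAlgebroid.bivector (A : SkewAlgebroid I F E) : BivectorField I F E :=
  Classical.epsilon A.IsLinearPoisson

/-! ### The algebroid `ℝ × E` -/

/-- The first component of a section of `ℝ × E`. -/
def fstFun (s : Cₛ^∞⟮I; ℝ × F, Trivial Q ℝ ×ᵇ E⟯) : C^∞⟮I, Q; 𝓘(ℝ, ℝ), ℝ⟯ :=
  ⟨fun q => (s q).1, fun q => (contMDiffAt_prod_section.1 (s.contMDiff q)).1⟩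

/-- The second component of a section of `ℝ × E`. -/
def sndSec (s : Cₛ^∞⟮I; ℝ × F, Trivial Q ℝ ×ᵇ E⟯) : Cₛ^∞⟮I; F, E⟯ :=
  ⟨fun q => (s q).2, fun q => (contMDiffAt_prod_section.1 (s.contMDiff q)).2⟩

/-- The section `(f, σ)` of `ℝ × E`. -/
def pairSec (f : C^∞⟮I, Q; 𝓘(ℝ, ℝ), ℝ⟯) (σ : Cₛ^∞⟮I; F, E⟯) :
    Cₛ^∞⟮I; ℝ × F, Trivial Q ℝ ×ᵇ E⟯ :=
  ⟨fun q => (f q, σ q), fun q =>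
    contMDiffAt_prod_section.2 ⟨f.contMDiff q, σ.contMDiff q⟩⟩

/-- The function `ρ(σ)(f)` as a smooth function. -/
def anchorFun (ρ : BundleHom I F E EQ (TangentSpace I)) (σ : Cₛ^∞⟮I; F, E⟯)
    (f : C^∞⟮I, Q; 𝓘(ℝ, ℝ), ℝ⟯) : C^∞⟮I, Q; 𝓘(ℝ, ℝ), ℝ⟯ :=
  ⟨anchorDeriv ρ σ f, contMDiff_anchorDeriv ρ σ f⟩

theorem anchorDeriv_add_left (ρ : BundleHom I F E EQ (TangentSpace I))
    (σ σ' : Cₛ^∞⟮I; F, E⟯) (f : Q → ℝ) (q : Q) :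
    anchorDeriv ρ (σ + σ') f q = anchorDeriv ρ σ f q + anchorDeriv ρ σ' f q := by
  simp [anchorDeriv]

theorem anchorDeriv_smul_left (ρ : BundleHom I F E EQ (TangentSpace I))
    (c : ℝ) (σ : Cₛ^∞⟮I; F, E⟯) (f : Q → ℝ) (q : Q) :
    anchorDeriv ρ (c • σ) f q = c * anchorDeriv ρ σ f q := by
  simp [anchorDeriv]

theorem anchorDeriv_funSmul_left (ρ : BundleHom I F E EQ (TangentSpace I))
    (g : C^∞⟮I, Q; 𝓘(ℝ, ℝ), ℝ⟯) (σ : Cₛ^∞⟮I; F, E⟯) (f : Q → ℝ) (q : Q) :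
    anchorDeriv ρ (funSmul g σ) f q = g q * anchorDeriv ρ σ f q := by
  simp [anchorDeriv, funSmul]

theorem mdiff_fun (f : C^∞⟮I, Q; 𝓘(ℝ, ℝ), ℝ⟯) (q : Q) : MDifferentiableAt I 𝓘(ℝ, ℝ) f q :=
  f.contMDiff.mdifferentiable (by simp) q

theorem anchorDeriv_add_right (ρ : BundleHom I F E EQ (TangentSpace I))
    (σ : Cₛ^∞⟮I; F, E⟯) (f g : C^∞⟮I, Q; 𝓘(ℝ, ℝ), ℝ⟯) (q : Q) :
    anchorDeriv ρ σ (fun q => f q + g q) q = anchorDeriv ρ σ f q + anchorDeriv ρ σ g q := by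
  have := mfderiv_add (mdiff_fun f q) (mdiff_fun g q)
  exact congrArg (fun L => L (ρ q (σ q))) this

theorem anchorDeriv_smul_right (ρ : BundleHom I F E EQ (TangentSpace I))
    (σ : Cₛ^∞⟮I; F, E⟯) (c : ℝ) (f : C^∞⟮I, Q; 𝓘(ℝ, ℝ), ℝ⟯) (q : Q) :
    anchorDeriv ρ σ (fun q => c * f q) q = c * anchorDeriv ρ σ f q := by
  have := const_smul_mfderiv (mdiff_fun f q) c
  exact congrArg (fun L => L (ρ q (σ q))) this

theorem anchorDeriv_mul_right (ρ : BundleHom I F E EQ (TangentSpace I))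
    (σ : Cₛ^∞⟮I; F, E⟯) (f g : C^∞⟮I, Q; 𝓘(ℝ, ℝ), ℝ⟯) (q : Q) :
    anchorDeriv ρ σ (fun q => f q * g q) q
      = f q * anchorDeriv ρ σ g q + g q * anchorDeriv ρ σ f q := by
  have := (HasMFDerivAt.mul (mdiff_fun f q).hasMFDerivAt (mdiff_fun g q).hasMFDerivAt).mfderiv
  exact congrArg (fun L => L (ρ q (σ q))) this

variable [∀ q, IsTopologicalAddGroup (E q)] [∀ q, ContinuousSMul ℝ (E q)]
  [FiniteDimensional ℝ F] [ContMDiffVectorBundle ∞ F E I]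

variable (I F E) in
/-- The projection `ℝ × E → E`. -/
def sndHom : BundleHom I (ℝ × F) (Trivial Q ℝ ×ᵇ E) F E :=
  ⟨fun q => ContinuousLinearMap.snd ℝ ℝ (E q), contMDiff_hom_of_sections fun _ _ hσ =>
    (contMDiffAt_prod_section.1 hσ).2⟩

/-- The skew-symmetric algebroid `ℝ × E` induced by an algebroid on `E` (and by the zero
endomorphism of `E`): `[(f, σ), (g, γ)] = (ρ(σ)(g) - ρ(γ)(f), [σ, γ])`, with anchor
`(f, σ) ↦ ρ(σ)`. -/
def SkewAlgebroid.timesReal (A : SkewAlgebroid I F E) :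
    SkewAlgebroid I (ℝ × F) (Trivial Q ℝ ×ᵇ E) where
  bracket := LinearMap.mk₂ ℝ
    (fun s t => pairSec
      (anchorFun A.anchor (sndSec s) (fstFun t) - anchorFun A.anchor (sndSec t) (fstFun s))
      (A.bracket (sndSec s) (sndSec t)))
    (fun s s' t => by
      refine ContMDiffSection.ext fun q => Prod.ext ?_ ?_
      · have h1 := anchorDeriv_add_left A.anchor (sndSec s) (sndSec s') (fstFun t) q
        have h2 := anchorDeriv_add_right A.anchor (sndSec t) (fstFun s) (fstFun s') q
        change anchorDeriv _ (sndSec s + sndSec s') _ q - anchorDeriv A.anchor (sndSec t)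
          (fun q => fstFun s q + fstFun s' q) q = (_ - _) + (_ - _)
        rw [h1, h2]
        simp only [anchorFun, ContMDiffMap.coeFn_mk]
        ring
      · exact congrArg (fun σ : Cₛ^∞⟮I; F, E⟯ => σ q)
          (A.bracket.map_add₂ (sndSec s) (sndSec s') (sndSec t)))
    (fun c s t => by
      refine ContMDiffSection.ext fun q => Prod.ext ?_ ?_
      · have h1 := anchorDeriv_smul_left A.anchor c (sndSec s) (fstFun t) q
        have h2 := anchorDeriv_smul_right A.anchor (sndSec t) c (fstFun s) q
        change anchorDeriv _ (c • sndSec s) _ q - anchorDeriv A.anchor (sndSec t)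
          (fun q => c * fstFun s q) q = c * (_ - _)
        rw [h1, h2]
        simp only [anchorFun, ContMDiffMap.coeFn_mk]
        ring
      · exact congrArg (fun σ : Cₛ^∞⟮I; F, E⟯ => σ q)
          (A.bracket.map_smul₂ c (sndSec s) (sndSec t)))
    (fun s t t' => by
      refine ContMDiffSection.ext fun q => Prod.ext ?_ ?_
      · have h1 := anchorDeriv_add_left A.anchor (sndSec t) (sndSec t') (fstFun s) q
        have h2 := anchorDeriv_add_right A.anchor (sndSec s) (fstFun t) (fstFun t') q
        change anchorDeriv _ (sndSec s) (fun q => fstFun t q + fstFun t' q) q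
          - anchorDeriv A.anchor (sndSec t + sndSec t') (fstFun s) q = (_ - _) + (_ - _)
        rw [h1, h2]
        simp only [anchorFun, ContMDiffMap.coeFn_mk]
        ring
      · exact congrArg (fun σ : Cₛ^∞⟮I; F, E⟯ => σ q)
          ((A.bracket (sndSec s)).map_add (sndSec t) (sndSec t')))
    (fun c s t => by
      refine ContMDiffSection.ext fun q => Prod.ext ?_ ?_
      · have h1 := anchorDeriv_smul_left A.anchor c (sndSec t) (fstFun s) q
        have h2 := anchorDeriv_smul_right A.anchor (sndSec s) c (fstFun t) q
        change anchorDeriv _ (sndSec s) (fun q => c * fstFun t q) q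
          - anchorDeriv A.anchor (c • sndSec t) (fstFun s) q = c * (_ - _)
        rw [h1, h2]
        simp only [anchorFun, ContMDiffMap.coeFn_mk]
        ring
      · exact congrArg (fun σ : Cₛ^∞⟮I; F, E⟯ => σ q)
          ((A.bracket (sndSec s)).map_smul c (sndSec t)))
  anchor := ⟨fun q => (A.anchor q).comp (sndHom I F E q),
    contMDiff_hom_comp (sndHom I F E).contMDiff A.anchor.contMDiff⟩
  skew s t := by
    refine ContMDiffSection.ext fun q => Prod.ext ?_ ?_
    · change anchorDeriv A.anchor (sndSec s) (fstFun t) q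
        - anchorDeriv A.anchor (sndSec t) (fstFun s) q
        = -(anchorDeriv A.anchor (sndSec t) (fstFun s) q
        - anchorDeriv A.anchor (sndSec s) (fstFun t) q)
      ring
    · change A.bracket (sndSec s) (sndSec t) q = -(A.bracket (sndSec t) (sndSec s) q)
      rw [A.skew]
      rfl
  leibniz s t f q := by
    refine Prod.ext ?_ ?_
    · have h1 := anchorDeriv_mul_right A.anchor (sndSec s) f (fstFun t) q
      have h2 := anchorDeriv_funSmul_left A.anchor f (sndSec t) (fstFun s) q
      change anchorDeriv A.anchor (sndSec s) (fun q => f q * fstFun t q) q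
        - anchorDeriv A.anchor (funSmul f (sndSec t)) (fstFun s) q
        = f q * (anchorDeriv A.anchor (sndSec s) (fstFun t) q
          - anchorDeriv A.anchor (sndSec t) (fstFun s) q)
          + anchorDeriv A.anchor (sndSec s) f q * fstFun t q
      rw [h1, h2]
      ring
    · exact A.leibniz (sndSec s) (sndSec t) f q

end Algebroids

/-! ### Mechanical systems with affine nonholonomic constraints -/

section Mechanics

variable {EQ : Type*} [NormedAddCommGroup EQ] [NormedSpace ℝ EQ]
  {HQ : Type*} [TopologicalSpace HQ] (I : ModelWithCorners ℝ EQ HQ)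
  {Q : Type*} [TopologicalSpace Q] [ChartedSpace HQ Q] [IsManifold I ∞ Q]
  (F : Type*) [NormedAddCommGroup F] [NormedSpace ℝ F] [FiniteDimensional ℝ F]
  (E : Q → Type*) [TopologicalSpace (TotalSpace F E)] [∀ q, TopologicalSpace (E q)]
  [∀ q, AddCommGroup (E q)] [∀ q, Module ℝ (E q)] [FiberBundle F E] [VectorBundle ℝ F E]
  [ContMDiffVectorBundle ∞ F E I]
  [∀ q, IsTopologicalAddGroup (E q)] [∀ q, ContinuousSMul ℝ (E q)]
  (FU : Type*) [NormedAddCommGroup FU] [NormedSpace ℝ FU] [FiniteDimensional ℝ FU]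
  (U : Q → Type*) [TopologicalSpace (TotalSpace FU U)] [∀ q, TopologicalSpace (U q)]
  [∀ q, AddCommGroup (U q)] [∀ q, Module ℝ (U q)] [FiberBundle FU U] [VectorBundle ℝ FU U]
  [ContMDiffVectorBundle ∞ FU U I]
  [∀ q, IsTopologicalAddGroup (U q)] [∀ q, ContinuousSMul ℝ (U q)]

/-- A vector subbundle `U` of `E` (given by its inclusion, a fibrewise injective vector bundle
morphism `U → E`), together with a bundle metric on `E`. -/
structure MetricSubbundle where
  /-- the inclusion `U → E` -/
  incl : BundleHom I FU U F E
  incl_injective : ∀ q, Function.Injective (incl q)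
  /-- the bundle metric on `E` -/
  metric : ContMDiffRiemannianMetric I ∞ F E

variable {I F E FU U}

namespace MetricSubbundle

variable (S : MetricSubbundle I F E FU U)

/-- The vector bundle morphism `E → U*`, `e ↦ 𝒢(e, ·)|_U`. -/
def flatHom : BundleHom I F E (FU →L[ℝ] ℝ) (CoFiber U) :=
  ⟨fun q => (ContinuousLinearMap.precomp ℝ (S.incl q)).comp (S.metric.inner q),
    contMDiff_hom_of_sections (F' := FU →L[ℝ] ℝ) (E' := CoFiber U) fun q₀ σ hσ =>
      contMDiffAt_hom_of_sections (F := FU) (E := U) (F' := ℝ) (E' := Trivial Q ℝ)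
        (φ := fun q => ((S.metric.inner q (σ q)).comp (S.incl q) : U q →L[ℝ] ℝ))
        fun _ hw => ContMDiffAt.clm_bundle_apply₂ (F₁ := F) (F₂ := F) (F₃ := ℝ)
          (E₃ := Trivial Q ℝ) (S.metric.contMDiff q₀) hσ
          ((S.incl.contMDiff q₀).clm_bundle_apply hw)⟩

theorem flatHom_apply (q : Q) (e : E q) (u : U q) :
    S.flatHom q e u = S.metric.inner q e (S.incl q u) := rfl

/-- The isomorphism `U → U*` induced by the restriction of the metric to `U`. -/
def gramHom : BundleHom I FU U (FU →L[ℝ] ℝ) (CoFiber U) :=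
  ⟨fun q => (S.flatHom q).comp (S.incl q),
    contMDiff_hom_comp (E'' := CoFiber U) S.incl.contMDiff S.flatHom.contMDiff⟩

theorem gramHom_apply (q : Q) (u w : U q) :
    S.gramHom q u w = S.metric.inner q (S.incl q u) (S.incl q w) := rfl

theorem gramHom_isInvertible (q : Q) : (S.gramHom q).IsInvertible := by
  have h1 : FiniteDimensional ℝ (U q) := VectorBundle.finiteDimensional ℝ FU U q
  have h2 : T2Space (U q) := FiberBundle.t2Space FU U q
  have h3 : T2Space (CoFiber U q) := FiberBundle.t2Space (FU →L[ℝ] ℝ) (CoFiber U) q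
  have h4 : FiniteDimensional ℝ (CoFiber U q) :=
    VectorBundle.finiteDimensional ℝ (FU →L[ℝ] ℝ) (CoFiber U) q
  have hinj : Function.Injective (S.gramHom q : U q →ₗ[ℝ] CoFiber U q) := by
    rw [injective_iff_map_eq_zero]
    intro u hu
    by_contra hne
    have h5 := S.metric.pos q (S.incl q u)
      (fun h => hne (S.incl_injective q (h.trans (map_zero _).symm)))
    have h6 : S.gramHom q u u = 0 := by
      have : S.gramHom q u = 0 := hu
      rw [this]
      rfl
    rw [gramHom_apply] at h6
    exact h5.ne' h6
  have hdim : Module.finrank ℝ (U q) = Module.finrank ℝ (CoFiber U q) := by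
    rw [VectorBundle.finrank_eq ℝ FU U q, VectorBundle.finrank_eq ℝ (FU →L[ℝ] ℝ) (CoFiber U) q]
    rw [← Subspace.dual_finrank_eq (K := ℝ) (V := FU)]
    exact (LinearMap.toContinuousLinearMap (𝕜 := ℝ) (E := FU) (F' := ℝ)).finrank_eq
  let e := LinearEquiv.ofInjectiveOfFinrankEq (S.gramHom q : U q →ₗ[ℝ] CoFiber U q) hinj hdim
  refine ⟨e.toContinuousLinearEquiv, ?_⟩
  ext u
  rfl

/-- The inverse isomorphism `U* → U`. -/
def sharpHom : BundleHom I (FU →L[ℝ] ℝ) (CoFiber U) FU U :=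
  ⟨fun q => (S.gramHom q).inverse,
    haveI : CompleteSpace FU := FiniteDimensional.complete ℝ FU
    contMDiff_hom_inverse (E' := CoFiber U) S.gramHom.contMDiff S.gramHom_isInvertible⟩

theorem gramHom_sharpHom (q : Q) (η : CoFiber U q) : S.gramHom q (S.sharpHom q η) = η := by
  obtain ⟨e, he⟩ := S.gramHom_isInvertible q
  change S.gramHom q ((S.gramHom q).inverse η) = η
  rw [← he]
  simp

theorem sharpHom_gramHom (q : Q) (u : U q) : S.sharpHom q (S.gramHom q u) = u :=
  (S.gramHom_isInvertible q).inverse_apply_self u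

/-- The orthogonal projector `𝒫 : E = U ⊕ U^⊥ → U` of the bundle metric. -/
def proj : BundleHom I F E FU U :=
  ⟨fun q => (S.sharpHom q).comp (S.flatHom q),
    contMDiff_hom_comp (E' := CoFiber U) S.flatHom.contMDiff S.sharpHom.contMDiff⟩

theorem proj_incl (q : Q) (u : U q) : S.proj q (S.incl q u) = u :=
  S.sharpHom_gramHom q u

/-- The vector `e - 𝒫(e)` is orthogonal to `U`. -/
theorem inner_sub_proj (q : Q) (e : E q) (u : U q) :
    S.metric.inner q (e - S.incl q (S.proj q e)) (S.incl q u) = 0 := by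
  have h := congrArg (fun η : CoFiber U q => η u) (S.gramHom_sharpHom q (S.flatHom q e))
  have h' : S.metric.inner q (S.incl q (S.proj q e)) (S.incl q u)
      = S.metric.inner q e (S.incl q u) := h
  rw [map_sub]
  exact sub_eq_zero.2 h'.symm

end MetricSubbundle

variable (I F E FU U)

/-- The data of a mechanical system subjected to affine nonholonomic constraints on `E`: a vector
subbundle `U` of `E`, a bundle metric on `E`, a function `𝕍` on `Q` and a section `X₀` of `E` with
`𝒫(X₀) = 0`. The constraint bundle is `𝒰_q = {X₀(q) + u | u ∈ U_q}`. -/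
structure AffineSystem extends MetricSubbundle I F E FU U where
  /-- the potential function `𝕍` -/
  potential : C^∞⟮I, Q; 𝓘(ℝ, ℝ), ℝ⟯
  /-- the section `X₀` of `E` -/
  X₀ : Cₛ^∞⟮I; F, E⟯
  proj_X₀ : ∀ q, toMetricSubbundle.proj q (X₀ q) = 0

variable {I F E FU U}

/-- The bidual bundle `Ũ` of the affine bundle `𝒰`. It is the vector subbundle of `ℝ × E` with
fibres `{(t, t X₀(q) + u) | t ∈ ℝ, u ∈ U_q}`; its elements are written here as pairs `(t, u)`, and
`AffineSystem.bidualIncl` is its inclusion in `ℝ × E`. Its dual bundle is the bundle `𝒰⁺` of affine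
functions on the fibres of `𝒰`. -/
abbrev Bidual {Q : Type*} (U : Q → Type*) : Q → Type _ := Trivial Q ℝ ×ᵇ U

namespace AffineSystem

variable (S : AffineSystem I F E FU U)

/-- The inclusion `Ũ → ℝ × E`, `(t, u) ↦ (t, t X₀ + u)`. -/
def bidualIncl : BundleHom I (ℝ × FU) (Bidual U) (ℝ × F) (Trivial Q ℝ ×ᵇ E) :=
  ⟨fun q => (ContinuousLinearMap.fst ℝ ℝ (U q)).prod
      ((ContinuousLinearMap.fst ℝ ℝ (U q)).smulRight (S.X₀ q)
        + (S.incl q).comp (ContinuousLinearMap.snd ℝ ℝ (U q))),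
    contMDiff_hom_of_sections (E' := Trivial Q ℝ ×ᵇ E) fun q₀ σ hσ => by
      have h := contMDiffAt_prod_section.1 hσ
      exact contMDiffAt_prod_section.2 ⟨h.1, (h.1.smul_section (S.X₀.contMDiff q₀)).add_section
        ((S.incl.contMDiff q₀).clm_bundle_apply h.2)⟩⟩

theorem bidualIncl_apply (q : Q) (t : ℝ) (u : U q) :
    S.bidualIncl q (t, u) = (t, t • S.X₀ q + S.incl q u) := rfl

/-- The projector `𝒫̃ : ℝ × E → Ũ`, `(t, e) ↦ (t, t X₀ + 𝒫(e))`. -/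
def bidualProj : BundleHom I (ℝ × F) (Trivial Q ℝ ×ᵇ E) (ℝ × FU) (Bidual U) :=
  ⟨fun q => (ContinuousLinearMap.fst ℝ ℝ (E q)).prod
      ((S.proj q).comp (ContinuousLinearMap.snd ℝ ℝ (E q))),
    contMDiff_hom_of_sections (E' := Bidual U) fun q₀ σ hσ => by
      have h := contMDiffAt_prod_section.1 hσ
      exact contMDiffAt_prod_section.2 ⟨h.1, (S.proj.contMDiff q₀).clm_bundle_apply h.2⟩⟩

theorem bidualIncl_bidualProj (q : Q) (t : ℝ) (e : E q) :
    S.bidualIncl q (S.bidualProj q (t, e)) = (t, t • S.X₀ q + S.incl q (S.proj q e)) := rfl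

theorem bidualProj_bidualIncl (q : Q) (v : Bidual U q) :
    S.bidualProj q (S.bidualIncl q v) = v := by
  refine Prod.ext rfl ?_
  change S.proj q (v.1 • S.X₀ q + S.incl q v.2) = v.2
  rw [map_add, map_smul, S.proj_X₀, smul_zero, zero_add, S.proj_incl]

variable (A : LieAlgebroid I F E)

/-- The skew-symmetric algebroid on `U`: `[σ, γ]_U = 𝒫 [σ, γ]`, `ρ_U = ρ|_U`. -/
def subAlgebroid : SkewAlgebroid I FU U :=
  A.toSkewAlgebroid.project S.incl S.proj S.proj_incl

/-- The projected skew-symmetric algebroid on `Ũ`: the bracket is `𝒫̃ [·, ·]_{ℝ × E}` and the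
anchor is the restriction of the anchor of `ℝ × E`. -/
def bidualAlgebroid : SkewAlgebroid I (ℝ × FU) (Bidual U) :=
  A.toSkewAlgebroid.timesReal.project S.bidualIncl S.bidualProj S.bidualProj_bidualIncl

/-- The inclusion `U → Ũ` with image the kernel of the distinguished section `φ` of `𝒰⁺`. In terms
of `ℝ × E` it is `u ↦ (0, u)`. -/
def kerIncl : BundleHom I FU U (ℝ × FU) (Bidual U) :=
  ⟨fun q => ContinuousLinearMap.inr ℝ ℝ (U q),
    contMDiff_hom_of_sections (E' := Bidual U) fun _ _ hσ =>
      contMDiffAt_prod_section.2 ⟨contMDiffAt_const, hσ⟩⟩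

/-- The section `(1, X₀)` of `Ũ`. -/
def oneX₀ : Cₛ^∞⟮I; ℝ × FU, Bidual U⟯ :=
  pairSec (1 : C^∞⟮I, Q; 𝓘(ℝ, ℝ), ℝ⟯) (0 : Cₛ^∞⟮I; FU, U⟯)

theorem bidualIncl_oneX₀ (q : Q) : S.bidualIncl q (oneX₀ (I := I) (FU := FU) q) = (1, S.X₀ q) := by
  refine Prod.ext rfl ?_
  change (1 : ℝ) • S.X₀ q + S.incl q 0 = S.X₀ q
  rw [one_smul, map_zero, add_zero]

/-- The distinguished section `φ` of `𝒰⁺`, `φ(t, t X₀ + u) = t`. -/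
def phi (q : Q) : CoFiber (Bidual U) q :=
  ContinuousLinearMap.fst ℝ ℝ (U q)

/-- The projection `μ : 𝒰⁺ → U*` on the fibres, the dual of the inclusion `U → Ũ`. -/
def muFib (q : Q) (ξ : CoFiber (Bidual U) q) : CoFiber U q :=
  ξ.comp (ContinuousLinearMap.inr ℝ ℝ (U q))

/-- The projection `μ : 𝒰⁺ → U*`. -/
def mu (ξ : CoTotal (ℝ × FU) (Bidual U)) : CoTotal FU U :=
  ⟨ξ.1, muFib ξ.1 ξ.2⟩

theorem muFib_apply (q : Q) (ξ : CoFiber (Bidual U) q) (u : U q) :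
    muFib q ξ u = ξ (kerIncl (I := I) (FU := FU) q u) := rfl

/-- The Hamiltonian function `H(η) = ½ 𝒢_{U*}(η, η) + 𝕍` on `U*`. The fibre metric induced on `U*`
is `𝒢_{U*}(η, η') = η(♯η')`, where `♯ : U* → U` is the isomorphism given by `𝒢|_U`. -/
def hamiltonian (η : CoTotal FU U) : ℝ :=
  1 / 2 * η.2 (S.sharpHom η.1 η.2) + S.potential η.1

/-- The Hamiltonian section `h : U* → 𝒰⁺` on the fibres,
`h(η)(t, t X₀ + u) = η(u) - t H(η)`. -/
def hamFib (q : Q) (η : CoFiber U q) : CoFiber (Bidual U) q :=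
  η.comp (ContinuousLinearMap.snd ℝ ℝ (U q))
    - S.hamiltonian ⟨q, η⟩ • ContinuousLinearMap.fst ℝ ℝ (U q)

theorem hamFib_apply (q : Q) (η : CoFiber U q) (t : ℝ) (u : U q) :
    S.hamFib q η (t, u) = η u - t * S.hamiltonian ⟨q, η⟩ := by
  change η u - S.hamiltonian ⟨q, η⟩ * t = _
  rw [mul_comm]

/-- The function `F_h` on `𝒰⁺` of the section `h`, the `φ`-component of `ξ - h(μ(ξ))`. -/
def funH (ξ : CoTotal (ℝ × FU) (Bidual U)) : ℝ :=
  ξ.2 (1, 0) - S.hamFib ξ.1 (muFib ξ.1 ξ.2) (1, 0)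

/-- The function `F_h` is characterized by `ξ - h(μ(ξ)) = F_h(ξ) φ`. -/
theorem sub_hamFib_muFib (q : Q) (ξ : CoFiber (Bidual U) q) :
    ξ - S.hamFib q (muFib q ξ) = S.funH ⟨q, ξ⟩ • phi q := by
  refine ContinuousLinearMap.ext fun v => ?_
  obtain ⟨t, u⟩ := v
  have h1 : ξ (t, u) = t * ξ (1, 0) + ξ (0, u) := by
    have : ((t, u) : Bidual U q) = t • ((1, 0) : Bidual U q) + ((0, u) : Bidual U q) :=
      Prod.ext (by simp) (by simp)
    rw [this, map_add, map_smul, smul_eq_mul]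
  have h2 : muFib q ξ u = ξ (0, u) := rfl
  change ξ (t, u) - S.hamFib q (muFib q ξ) (t, u)
    = (ξ (1, 0) - S.hamFib q (muFib q ξ) (1, 0)) * t
  rw [h1, hamFib_apply, hamFib_apply, h2, map_zero]
  ring

/-- `R` is the Hamiltonian vector field of the section `h`: `R(G) ∘ μ = {G ∘ μ, F_h}` for every
smooth function `G` on `U*`, for the linear almost Poisson bracket on `𝒰⁺`. -/
def IsHamiltonianField
    (R : ∀ η : CoTotal FU U, TangentSpace (I.prod 𝓘(ℝ, FU →L[ℝ] ℝ)) η) : Prop :=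
  ∀ (G : C^∞⟮I.prod 𝓘(ℝ, FU →L[ℝ] ℝ), CoTotal FU U; 𝓘(ℝ, ℝ), ℝ⟯)
    (ξ : CoTotal (ℝ × FU) (Bidual U)),
    dif (I.prod 𝓘(ℝ, FU →L[ℝ] ℝ)) G (mu ξ) (R (mu ξ))
      = (S.bidualAlgebroid A).bivector.poisson (fun ξ => G (mu ξ)) S.funH ξ

/-- The Hamiltonian vector field `R_h` on `U*`, by definite description. Its integral curves are
the solutions of the Hamilton equations. -/
def hamiltonianField (η : CoTotal FU U) : TangentSpace (I.prod 𝓘(ℝ, FU →L[ℝ] ℝ)) η :=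
  Classical.epsilon (S.IsHamiltonianField A) η

variable (α : Cₛ^∞⟮I; FU →L[ℝ] ℝ, CoFiber U⟯)

/-- The vector field `R_h^α = Tτ_{U*} ∘ R_h ∘ α` on `Q`. -/
def baseField (q : Q) : TangentSpace I q :=
  mfderiv (I.prod 𝓘(ℝ, FU →L[ℝ] ℝ)) I
    (TotalSpace.proj : CoTotal FU U → Q) ⟨q, α q⟩ (S.hamiltonianField A ⟨q, α q⟩)

/-- The derivative `η^∨(H)` of the function `H` on `U*` along the vertical lift of `η ∈ U*_q`, at
the point `β ∈ U*_q`. -/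
def vertDeriv (H : CoTotal FU U → ℝ) {q : Q} (η β : CoFiber U q) : ℝ :=
  deriv (fun t : ℝ => H ⟨q, β + t • η⟩) 0

theorem vertDeriv_hamiltonian {q : Q} (η β : CoFiber U q) :
    vertDeriv S.hamiltonian η β = η (S.sharpHom q β) := by
  have hsymm : β (S.sharpHom q η) = η (S.sharpHom q β) := by
    have h1 := congrArg (fun θ : CoFiber U q => θ (S.sharpHom q η)) (S.gramHom_sharpHom q β)
    have h2 := congrArg (fun θ : CoFiber U q => θ (S.sharpHom q β)) (S.gramHom_sharpHom q η)
    simp only [MetricSubbundle.gramHom_apply] at h1 h2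
    rw [← h1, ← h2, S.metric.symm]
  have h3 : (fun t : ℝ => S.hamiltonian ⟨q, β + t • η⟩) = fun t : ℝ =>
      1 / 2 * (β (S.sharpHom q β) + t * (2 * η (S.sharpHom q β))
        + t ^ 2 * η (S.sharpHom q η)) + S.potential q := by
    funext t
    have h4 : S.sharpHom q (β + t • η) = S.sharpHom q β + t • S.sharpHom q η := by
      rw [map_add, map_smul]
    change 1 / 2 * (β (S.sharpHom q (β + t • η)) + t * η (S.sharpHom q (β + t • η)))
      + S.potential q = _
    rw [h4, map_add, map_add, map_smul, map_smul, smul_eq_mul, smul_eq_mul, hsymm]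
    ring
  rw [vertDeriv, h3]
  have h5 : HasDerivAt (fun t : ℝ => 1 / 2 * (β (S.sharpHom q β) + t * (2 * η (S.sharpHom q β))
        + t ^ 2 * η (S.sharpHom q η)) + S.potential q)
      (1 / 2 * (1 * (2 * η (S.sharpHom q β))
        + (2 : ℕ) * (0 : ℝ) ^ (2 - 1) * 1 * η (S.sharpHom q η))) 0 :=
    (((((hasDerivAt_id (0 : ℝ)).mul_const _).const_add _).add
      (((hasDerivAt_id (0 : ℝ)).pow 2).mul_const _)).const_mul _).add_const _
  rw [h5.deriv]
  norm_num
  ring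

/-- There is a smooth section `ζ` of `U` with `η(ζ) = η^∨(H) ∘ α` for all `η`. -/
theorem exists_zeta : ∃ ζ : Cₛ^∞⟮I; FU, U⟯, ∀ (q : Q) (η : CoFiber U q),
    η (ζ q) = vertDeriv S.hamiltonian η (α q) :=
  ⟨mapSec S.sharpHom α, fun q η => (S.vertDeriv_hamiltonian η (α q)).symm⟩

/-- The section `ζ_H^α` of `U`, characterized by `η(ζ_H^α) = η^∨(H) ∘ α` for all `η`. -/
def zeta : Cₛ^∞⟮I; FU, U⟯ :=
  Classical.choose (S.exists_zeta α)

/-- The left-hand side `i_{ζ_H^α} d^U α + μ ∘ i_{(1, X₀)} d^Ũ (h ∘ α)` of the Hamilton-Jacobi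
equation, a section of `U*` written as a function of sections of `U`. -/
def hamiltonJacobi : Cₛ^∞⟮I; FU, U⟯ → Q → ℝ :=
  contract (S.zeta α) ((S.subAlgebroid A).almostDiff α)
    + pullForm kerIncl
      (contract oneX₀ ((S.bidualAlgebroid A).almostDiff fun q => S.hamFib q (α q)))

end AffineSystem

end Mechanics

end AffineHJ

end

/-! Write `R` for `R_h`, `ζ` for `ζ_H^α` and `τ` for the bundle projection. Statement (i) says that
`R_h^α` and `R` are `α`-related, that is `Tα(R_h^α(q)) = R(α(q))` for every `q`. One direction is
the chain rule along an integral curve. The other applies (i) to an integral curve through `q` and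
differentiates at time `0`; such a curve exists because `R_h^α = ρ(X₀ + ζ)` is smooth
(`baseField_apply`).

The pointwise equality is tested on covectors. On the total space of a dual bundle, the covectors `d
σ̂ + d(k ∘ τ)` fill every cotangent space (`covec_surjective`): vertically such a covector is the
vector `σ(q)`, and the remainder comes from the base. In particular `dH = d ζ̂ + d(f ∘ τ)` at `α(q)`
for some `f`, since `ζ` is by definition the fibre derivative of `H` along `α`. As `F_h` is the
linear function of `(1, X₀)` plus `H ∘ μ`, the bracket gives `R(σ̂ + k ∘ τ) = -α(𝒫[σ, X₀ + ζ]) +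
ρ(X₀ + ζ)(k) - ρ(σ)(f)` at `α(q)`, while `Tα(R_h^α)` gives `ρ(X₀ + ζ)(α(σ)) + ρ(X₀ + ζ)(k)`. The
terms in `k` cancel. Differentiating `H ∘ α` yields `ρ(σ)(f) = ρ(σ)(H ∘ α) - ρ(σ)(α(ζ))` at `q`, and
the difference becomes exactly the left-hand side of the Hamilton-Jacobi equation on `σ`
(`hamiltonJacobi_apply`, `mfderiv_section_baseField_eq_iff`).

The bivector is unique because its values on the spanning covectors are prescribed. It exists
because the prescribed form vanishes on every pair `(σ, f)` with `d σ̂ + d(f ∘ τ) = 0`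
(`poissonForm_eq_zero_of_covec`), a consequence of the Leibniz rule. The field `R` exists because
the bracket of a section of `U` with `(1, X₀ + γ)` stays in the kernel of `φ` (`bidual_bracket`), so
that `{G ∘ μ, F_h}` is constant on the fibres of `μ`. -/

noncomputable section

namespace AffineHJ

/-! ### Vertical derivatives, and smooth functions and sections with prescribed values at a point -/

section VectorBundleGeometry

open Filter Topology

variable {EQ : Type*} [NormedAddCommGroup EQ] [NormedSpace ℝ EQ]
  {HQ : Type*} [TopologicalSpace HQ] {I : ModelWithCorners ℝ EQ HQ}
  {Q : Type*} [TopologicalSpace Q] [ChartedSpace HQ Q]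
  {F : Type*} [NormedAddCommGroup F] [NormedSpace ℝ F]
  {E : Q → Type*} [TopologicalSpace (TotalSpace F E)] [∀ q, TopologicalSpace (E q)]
  [∀ q, AddCommGroup (E q)] [∀ q, Module ℝ (E q)] [FiberBundle F E] [VectorBundle ℝ F E]

/-- The trivialization at `q` is linear on the fibre over `q`, so in it the line is affine with
constant base coordinate. -/
theorem hasMFDerivAt_vertical_line (q : Q) (p v : E q) :
    HasMFDerivAt 𝓘(ℝ, ℝ) (I.prod 𝓘(ℝ, F)) (fun t : ℝ => (⟨q, p + t • v⟩ : TotalSpace F E)) 0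
      ((1 : ℝ →L[ℝ] ℝ).smulRight ((0, (trivializationAt F E q ⟨q, v⟩).2) : EQ × F)) := by
  have hq := FiberBundle.mem_baseSet_trivializationAt F E q
  have hlin : ∀ w : E q, (trivializationAt F E q ⟨q, w⟩).2 =
      (trivializationAt F E q).continuousLinearEquivAt ℝ q hq w := fun w => rfl
  have hfun : ∀ t : ℝ, (trivializationAt F E q ⟨q, p + t • v⟩).2 =
      (trivializationAt F E q ⟨q, p⟩).2 + t • (trivializationAt F E q ⟨q, v⟩).2 := fun t => by
    simp only [hlin, map_add, map_smul]
  have hd : HasFDerivAt (fun t : ℝ => ((extChartAt I q q,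
      (trivializationAt F E q ⟨q, p⟩).2 + t • (trivializationAt F E q ⟨q, v⟩).2) : EQ × F))
      ((1 : ℝ →L[ℝ] ℝ).smulRight ((0, (trivializationAt F E q ⟨q, v⟩).2) : EQ × F)) 0 := by
    have h1 := ((hasDerivAt_id (0 : ℝ)).smul_const
      (trivializationAt F E q ⟨q, v⟩).2).const_add (trivializationAt F E q ⟨q, p⟩).2
    have h2 := ((hasDerivAt_const (0 : ℝ) (extChartAt I q q)).prodMk h1).hasFDerivAt
    have h3 : (1 : ℝ →L[ℝ] ℝ).smulRight ((0, (trivializationAt F E q ⟨q, v⟩).2) : EQ × F) =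
        ContinuousLinearMap.toSpanSingleton ℝ
          ((0, (1 : ℝ) • (trivializationAt F E q ⟨q, v⟩).2) : EQ × F) := by
      ext <;> simp
    rw [h3]
    exact h2
  have hcont : ContMDiff 𝓘(ℝ, ℝ) (I.prod 𝓘(ℝ, F)) ∞
      (fun t : ℝ => (⟨q, p + t • v⟩ : TotalSpace F E)) := by
    intro t
    rw [contMDiffAt_totalSpace]
    refine ⟨contMDiffAt_const, ?_⟩
    simp only [hfun]
    exact (contDiff_const.add (contDiff_id.smul contDiff_const)).contMDiff.contMDiffAt
  refine ⟨hcont.continuous.continuousAt, ?_⟩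
  have hw : writtenInExtChartAt 𝓘(ℝ, ℝ) (I.prod 𝓘(ℝ, F)) 0
      (fun t : ℝ => (⟨q, p + t • v⟩ : TotalSpace F E)) = fun t : ℝ => ((extChartAt I q q,
      (trivializationAt F E q ⟨q, p⟩).2 + t • (trivializationAt F E q ⟨q, v⟩).2) : EQ × F) := by
    funext t
    rw [← hfun]
    simp only [writtenInExtChartAt, Function.comp, FiberBundle.extChartAt,
      extChartAt_model_space_eq_id, PartialEquiv.refl_symm, PartialEquiv.refl_coe, id]
    have h1 : (trivializationAt F E q (⟨q, p + t • v⟩ : TotalSpace F E)).1 = q :=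
      Trivialization.coe_fst' _ hq
    refine Prod.ext ?_ rfl
    change extChartAt I q (trivializationAt F E q (⟨q, p + t • v⟩ : TotalSpace F E)).1 = _
    rw [h1]
  rw [hw]
  exact hd.hasFDerivWithinAt

/-- Links the fibre derivative, through which `ζ_H^α` is defined, with the differential on the total
space. -/
theorem hasDerivAt_vertical {G : TotalSpace F E → ℝ} {q : Q} {p : E q}
    (hG : MDifferentiableAt (I.prod 𝓘(ℝ, F)) 𝓘(ℝ, ℝ) G ⟨q, p⟩) (v : E q) :
    HasDerivAt (fun t : ℝ => G ⟨q, p + t • v⟩)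
      (dif (I.prod 𝓘(ℝ, F)) G ⟨q, p⟩
        ((0, (trivializationAt F E q ⟨q, v⟩).2) : EQ × F)) 0 := by
  have h1 : HasMFDerivAt (I.prod 𝓘(ℝ, F)) 𝓘(ℝ, ℝ) G ⟨q, p + (0 : ℝ) • v⟩
      (dif (I.prod 𝓘(ℝ, F)) G ⟨q, p⟩) := by
    have h0 : p + (0 : ℝ) • v = p := by simp
    rw [h0]
    exact hG.hasMFDerivAt
  have h2 := (h1.comp (0 : ℝ) (hasMFDerivAt_vertical_line (I := I) q p v)).hasFDerivAt
  have h3 := HasFDerivAt.hasDerivAt (𝕜 := ℝ) (F := ℝ) h2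
  refine h3.congr_deriv ?_
  change dif (I.prod 𝓘(ℝ, F)) G ⟨q, p⟩
    ((1 : ℝ) • ((0, (trivializationAt F E q ⟨q, v⟩).2) : EQ × F)) = _
  rw [one_smul]

/-- The chart of the total space at `ξ` has the chart of the base as its first component, so in
charts the projection is `Prod.fst`. -/
theorem mfderiv_proj_apply [IsManifold I ∞ Q] (ξ : TotalSpace F E) (w : EQ × F) :
    mfderiv (I.prod 𝓘(ℝ, F)) I (TotalSpace.proj : TotalSpace F E → Q) ξ w = w.1 := by
  have hd : HasMFDerivAt (I.prod 𝓘(ℝ, F)) I (TotalSpace.proj : TotalSpace F E → Q) ξ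
      (ContinuousLinearMap.fst ℝ EQ F) := by
    refine ⟨(FiberBundle.continuous_proj F E).continuousAt, ?_⟩
    refine (hasFDerivWithinAt_fst (𝕜 := ℝ) (E := EQ) (F := F)).congr_of_eventuallyEq ?_ ?_
    · filter_upwards [extChartAt_target_mem_nhdsWithin (I := I.prod 𝓘(ℝ, F)) ξ] with y hy
      rw [FiberBundle.extChartAt_target] at hy
      have h3 : extChartAt I ξ.proj ((trivializationAt F E ξ.proj).toOpenPartialHomeomorph.symm
          ((extChartAt I ξ.proj).symm y.1, y.2)).proj = y.1 := by
        rw [Trivialization.proj_symm_apply' _ hy.1.2]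
        exact (extChartAt I ξ.proj).right_inv hy.1.1
      simp only [writtenInExtChartAt, Function.comp]
      rw [FiberBundle.extChartAt]
      exact h3
    · simp only [writtenInExtChartAt, Function.comp, extChartAt_to_inv]
      rw [FiberBundle.extChartAt]
      exact congrArg _ (Trivialization.coe_fst' _
        (FiberBundle.mem_baseSet_trivializationAt F E ξ.proj)).symm
  rw [hd.mfderiv]
  rfl

variable [FiniteDimensional ℝ EQ] [T2Space Q] [IsManifold I ∞ Q]

theorem exists_dif_eq (q : Q) (l : TangentSpace I q →L[ℝ] ℝ) :
    ∃ f : C^∞⟮I, Q; 𝓘(ℝ, ℝ), ℝ⟯, dif I f q = l := by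
  obtain ⟨ψ⟩ : Nonempty (SmoothBumpFunction I q) := inferInstance
  let m : TangentSpace I q →L[ℝ] EQ := mfderiv I 𝓘(ℝ, EQ) (extChartAt I q) q
  have hm : m.IsInvertible := isInvertible_mfderiv_extChartAt (mem_extChartAt_source q)
  obtain ⟨e, he⟩ := hm
  -- Undoing the derivative of the chart makes `l' ∘ extChartAt I q` a local function with
  -- differential `l` at `q`; the bump function globalizes it.
  let l' : EQ →L[ℝ] ℝ := l.comp (e.symm : EQ →L[ℝ] TangentSpace I q)
  have h1 : ContMDiffOn I 𝓘(ℝ, ℝ) ∞ (fun x => l' (extChartAt I q x)) (chartAt HQ q).source :=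
    l'.contMDiff.comp_contMDiffOn contMDiffOn_extChartAt
  refine ⟨⟨fun x => ψ x • l' (extChartAt I q x), ψ.contMDiff_smul h1⟩, ?_⟩
  have h2 : (fun x => ψ x • l' (extChartAt I q x)) =ᶠ[𝓝 q] fun x => l' (extChartAt I q x) := by
    filter_upwards [ψ.eventuallyEq_one] with x hx
    simp [hx]
  have h3 : HasMFDerivAt I 𝓘(ℝ, EQ) (extChartAt I q) q m :=
    (mdifferentiableAt_extChartAt (mem_chart_source HQ q)).hasMFDerivAt
  have h4 := (l'.hasMFDerivAt (x := extChartAt I q q)).comp q h3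
  have h5 := (h4.congr_of_eventuallyEq h2).mfderiv
  refine h5.trans ?_
  ext v
  change l (e.symm (m v)) = l v
  rw [← he]
  simp

/-- Smooth functions separate tangent vectors. -/
theorem eq_of_dif_eq {q : Q} {v w : TangentSpace I q}
    (h : ∀ f : C^∞⟮I, Q; 𝓘(ℝ, ℝ), ℝ⟯, dif I f q v = dif I f q w) : v = w := by
  have h1 : ∀ l : EQ →L[ℝ] ℝ, l v = l w := fun l => by
    obtain ⟨f, hf⟩ := exists_dif_eq (I := I) q l
    have := h f
    rwa [hf] at this
  exact (SeparatingDual.eq_iff_forall_dual_eq (R := ℝ) (V := EQ)).2 h1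

variable [FiniteDimensional ℝ F] [ContMDiffVectorBundle ∞ F E I]

theorem exists_section_eq (q : Q) (v : E q) : ∃ σ : Cₛ^∞⟮I; F, E⟯, σ q = v := by
  obtain ⟨s, hs, hsσ⟩ := FiberBundle.exists_contMDiffOn_extend (k := ∞) I F v
  obtain ⟨u, hus, hu, hqu⟩ := mem_nhds_iff.1 hs
  obtain ⟨ψ, -, hψ⟩ := (SmoothBumpFunction.nhds_basis_tsupport (I := I) q).mem_iff.1
    (hu.mem_nhds hqu)
  refine ⟨⟨fun x => ψ x • FiberBundle.extend F v x,
    (ψ.contMDiff.contMDiffOn).smul_section_of_tsupport hu hψ (hsσ.mono hus)⟩, ?_⟩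
  change ψ q • FiberBundle.extend F v q = v
  rw [ψ.eq_one, one_smul, FiberBundle.extend_apply_self]

/-- Every smooth section vanishing at a point is a sum of products of sections with functions
vanishing at that point. -/
theorem section_induction_of_eq_zero {q : Q} {P : Cₛ^∞⟮I; F, E⟯ → Prop} (h0 : P 0)
    (hadd : ∀ σ τ, P σ → P τ → P (σ + τ))
    (hmul : ∀ (g : C^∞⟮I, Q; 𝓘(ℝ, ℝ), ℝ⟯) (σ : Cₛ^∞⟮I; F, E⟯), g q = 0 → P (funSmul g σ))
    {δ : Cₛ^∞⟮I; F, E⟯} (hδ : δ q = 0) : P δ := by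
  have : ContMDiffVectorBundle 1 F E I := ContMDiffVectorBundle.of_le (n := ∞) (by simp)
  let e := trivializationAt F E q
  let b := Module.finBasis ℝ F
  obtain ⟨ψ, -, hψ⟩ := (SmoothBumpFunction.nhds_basis_tsupport (I := I) q).mem_iff.1
    (e.open_baseSet.mem_nhds (FiberBundle.mem_baseSet_trivializationAt F E q))
  let c : Fin (Module.finrank ℝ F) → Q → ℝ := fun i x => e.localFrameCoeff I b i x (δ x)
  have hc : ∀ i, ContMDiffOn I 𝓘(ℝ, ℝ) ∞ (c i) e.baseSet := fun i =>
    contMDiffOn_baseSet_localFrameCoeff b δ.contMDiff.contMDiffOn i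
  have hψ0 : ∀ x, x ∉ e.baseSet → ψ x = 0 := fun x hx =>
    image_eq_zero_of_notMem_tsupport fun h => hx (hψ h)
  let ε : Fin (Module.finrank ℝ F) → Cₛ^∞⟮I; F, E⟯ := fun i =>
    ⟨fun x => ψ x • e.localFrame b i x,
      (ψ.contMDiff.contMDiffOn).smul_section_of_tsupport e.open_baseSet hψ
        (e.contMDiffOn_localFrame_baseSet ∞ b i)⟩
  let g : Fin (Module.finrank ℝ F) → C^∞⟮I, Q; 𝓘(ℝ, ℝ), ℝ⟯ := fun i =>
    ⟨fun x => ψ x • c i x, contMDiff_of_tsupport fun x hx => by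
      have hx' : x ∈ e.baseSet := hψ (tsupport_smul_subset_left _ _ hx)
      exact ψ.contMDiffAt.smul ((hc i x hx').contMDiffAt (e.open_baseSet.mem_nhds hx'))⟩
  -- The frame and the coefficients of `δ` are both only local, so each takes one factor `ψ`. This
  -- recovers `ψ² δ`, and the rest is `(1 - ψ²) δ`, whose coefficient vanishes at `q` since `ψ q =
  -- 1`.
  let k : C^∞⟮I, Q; 𝓘(ℝ, ℝ), ℝ⟯ :=
    ⟨fun x => 1 - ψ x * ψ x, contMDiff_const.sub (ψ.contMDiff.mul ψ.contMDiff)⟩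
  have hsum : ∀ (s : Finset (Fin (Module.finrank ℝ F))), P (∑ i ∈ s, funSmul (g i) (ε i)) := by
    intro s
    induction s using Finset.cons_induction with
    | empty => simpa using h0
    | cons i s hi ih =>
      rw [Finset.sum_cons]
      refine hadd _ _ (hmul _ _ ?_) ih
      change ψ q • e.localFrameCoeff I b i q (δ q) = 0
      rw [hδ, map_zero, smul_zero]
  have hk : P (funSmul k δ) := hmul _ _ (by
    change 1 - ψ q * ψ q = 0
    rw [ψ.eq_one]
    norm_num)
  have key : δ = funSmul k δ + ∑ i, funSmul (g i) (ε i) := by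
    refine ContMDiffSection.ext fun x => ?_
    have h1 : (funSmul k δ + ∑ i, funSmul (g i) (ε i)) x
        = (1 - ψ x * ψ x) • δ x + ∑ i, (ψ x • c i x) • (ψ x • e.localFrame b i x) := by
      rw [ContMDiffSection.coe_add, Pi.add_apply]
      congr 1
      have h2 := map_sum (ContMDiffSection.coeAddHom I F ∞ E) (fun i => funSmul (g i) (ε i))
        Finset.univ
      have h3 := congrFun h2 x
      rw [Finset.sum_apply] at h3
      exact h3
    rw [h1]
    by_cases hx : x ∈ e.baseSet
    · have h2 : δ x = ∑ i, c i x • e.localFrame b i x :=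
        Trivialization.eq_sum_localFrameCoeff_smul (s := δ) hx
      have h3 : ∑ i, (ψ x • c i x) • (ψ x • e.localFrame b i x)
          = (ψ x * ψ x) • ∑ i, c i x • e.localFrame b i x := by
        rw [Finset.smul_sum]
        refine Finset.sum_congr rfl fun i _ => ?_
        simp only [smul_smul, smul_eq_mul]
        congr 1
        ring
      rw [h3, ← h2, ← add_smul]
      simp
    · simp [hψ0 x hx]
  rw [key]
  exact hadd _ _ hk (hsum _)

end VectorBundleGeometry

/-! ### Cotangent spaces of a dual bundle -/

section DualBundle

variable {EQ : Type*} [NormedAddCommGroup EQ] [NormedSpace ℝ EQ]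
  {HQ : Type*} [TopologicalSpace HQ] {I : ModelWithCorners ℝ EQ HQ}
  {Q : Type*} [TopologicalSpace Q] [ChartedSpace HQ Q] [IsManifold I ∞ Q]
  {F : Type*} [NormedAddCommGroup F] [NormedSpace ℝ F]
  {E : Q → Type*} [TopologicalSpace (TotalSpace F E)] [∀ q, TopologicalSpace (E q)]
  [∀ q, AddCommGroup (E q)] [∀ q, Module ℝ (E q)] [FiberBundle F E] [VectorBundle ℝ F E]

theorem contMDiff_linFun (σ : Cₛ^∞⟮I; F, E⟯) :
    ContMDiff (I.prod 𝓘(ℝ, F →L[ℝ] ℝ)) 𝓘(ℝ, ℝ) ∞ (linFun σ) := by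
  have hσ : ContMDiff (I.prod 𝓘(ℝ, F →L[ℝ] ℝ)) (I.prod 𝓘(ℝ, F)) ∞
      (fun ξ : CoTotal F E => TotalSpace.mk' F ξ.1 (σ ξ.1)) :=
    σ.contMDiff.comp (contMDiff_proj (CoFiber E))
  -- The tautological family `ξ ↦ ξ.2` over `E*` is smooth because, as a map into the total space,
  -- it is the identity.
  have h := ContMDiff.clm_bundle_apply (F₁ := F) (F₂ := ℝ) (E₁ := E) (E₂ := Trivial Q ℝ)
    (b := fun ξ : CoTotal F E => ξ.1) (ϕ := fun ξ => ξ.2) contMDiff_id hσ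
  exact fun ξ => (contMDiffAt_totalSpace.1 (h ξ)).2

theorem mdiff_linFun (σ : Cₛ^∞⟮I; F, E⟯) (ξ : CoTotal F E) :
    MDifferentiableAt (I.prod 𝓘(ℝ, F →L[ℝ] ℝ)) 𝓘(ℝ, ℝ) (linFun σ) ξ :=
  (contMDiff_linFun σ).mdifferentiable (by simp) ξ

theorem mdiff_proj (ξ : CoTotal F E) :
    MDifferentiableAt (I.prod 𝓘(ℝ, F →L[ℝ] ℝ)) I (TotalSpace.proj : CoTotal F E → Q) ξ :=
  (contMDiff_proj (n := ∞) (CoFiber E)).mdifferentiable (by simp) ξ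

theorem mdiff_base (f : C^∞⟮I, Q; 𝓘(ℝ, ℝ), ℝ⟯) (ξ : CoTotal F E) :
    MDifferentiableAt (I.prod 𝓘(ℝ, F →L[ℝ] ℝ)) 𝓘(ℝ, ℝ) (fun ξ : CoTotal F E => f ξ.1) ξ :=
  (mdiff_fun f ξ.1).comp ξ (mdiff_proj ξ)

/-- The vertical tangent vector at a point over `q` with direction `η`, in the trivialization
at `q`. -/
def vertVec {q : Q} (η : CoFiber E q) : EQ × (F →L[ℝ] ℝ) :=
  (0, (trivializationAt (F →L[ℝ] ℝ) (CoFiber E) q ⟨q, η⟩).2)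

theorem vertVec_surjective {q : Q} (w : F →L[ℝ] ℝ) :
    ∃ η : CoFiber E q, vertVec (EQ := EQ) (F := F) η = (0, w) := by
  have hq := FiberBundle.mem_baseSet_trivializationAt (F →L[ℝ] ℝ) (CoFiber E) q
  let e := (trivializationAt (F →L[ℝ] ℝ) (CoFiber E) q).continuousLinearEquivAt ℝ q hq
  exact ⟨e.symm w, Prod.ext rfl (e.apply_symm_apply w)⟩

theorem dif_linFun_vertVec (σ : Cₛ^∞⟮I; F, E⟯) (ξ : CoTotal F E) (η : CoFiber E ξ.1) :
    dif (I.prod 𝓘(ℝ, F →L[ℝ] ℝ)) (linFun σ) ξ (vertVec (EQ := EQ) (F := F) η) = η (σ ξ.1) := by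
  have h1 := hasDerivAt_vertical (mdiff_linFun σ ⟨ξ.1, ξ.2⟩) η
  have h2 : HasDerivAt (fun t : ℝ => ξ.2 (σ ξ.1) + t • η (σ ξ.1)) ((1 : ℝ) • η (σ ξ.1)) 0 :=
    ((hasDerivAt_id (0 : ℝ)).smul_const (η (σ ξ.1))).const_add _
  rw [one_smul] at h2
  exact h1.unique h2

theorem dif_base (f : C^∞⟮I, Q; 𝓘(ℝ, ℝ), ℝ⟯) (ξ : CoTotal F E) (w : EQ × (F →L[ℝ] ℝ)) :
    dif (I.prod 𝓘(ℝ, F →L[ℝ] ℝ)) (fun ξ : CoTotal F E => f ξ.1) ξ w = dif I f ξ.1 w.1 := by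
  have h := mfderiv_comp ξ (mdiff_fun f ξ.1) (mdiff_proj ξ)
  have h1 : dif (I.prod 𝓘(ℝ, F →L[ℝ] ℝ)) (fun ξ : CoTotal F E => f ξ.1) ξ w =
      dif I f ξ.1 (mfderiv (I.prod 𝓘(ℝ, F →L[ℝ] ℝ)) I
        (TotalSpace.proj : CoTotal F E → Q) ξ w) :=
    congrArg (fun L => L w) h
  rw [h1, mfderiv_proj_apply]

/-- The covector `d σ̂ + d (f ∘ τ)` at a point of `E*`, as a linear function of `(σ, f)`. -/
def covec (ξ : CoTotal F E) :
    (Cₛ^∞⟮I; F, E⟯ × C^∞⟮I, Q; 𝓘(ℝ, ℝ), ℝ⟯) →ₗ[ℝ]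
      (TangentSpace (I.prod 𝓘(ℝ, F →L[ℝ] ℝ)) ξ →L[ℝ] ℝ) :=
  LinearMap.coprod
    { toFun := fun σ => dif (I.prod 𝓘(ℝ, F →L[ℝ] ℝ)) (linFun σ) ξ
      map_add' := fun σ τ => by
        have h : linFun (σ + τ) = (linFun σ + linFun τ : CoTotal F E → ℝ) :=
          funext fun ξ => map_add ξ.2 _ _
        rw [h]
        exact mfderiv_add (mdiff_linFun σ ξ) (mdiff_linFun τ ξ)
      map_smul' := fun c σ => by
        have h : linFun (c • σ) = (c • linFun σ : CoTotal F E → ℝ) :=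
          funext fun ξ => map_smul ξ.2 _ _
        rw [h]
        exact const_smul_mfderiv (mdiff_linFun σ ξ) c }
    { toFun := fun f => dif (I.prod 𝓘(ℝ, F →L[ℝ] ℝ)) (fun ξ : CoTotal F E => f ξ.1) ξ
      map_add' := fun f g => mfderiv_add (mdiff_base f ξ) (mdiff_base g ξ)
      map_smul' := fun c f => const_smul_mfderiv (mdiff_base f ξ) c }

theorem covec_apply (ξ : CoTotal F E) (σ : Cₛ^∞⟮I; F, E⟯) (f : C^∞⟮I, Q; 𝓘(ℝ, ℝ), ℝ⟯) :
    covec ξ (σ, f) = dif (I.prod 𝓘(ℝ, F →L[ℝ] ℝ)) (linFun σ) ξ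
      + dif (I.prod 𝓘(ℝ, F →L[ℝ] ℝ)) (fun ξ : CoTotal F E => f ξ.1) ξ := rfl

theorem covec_lin (ξ : CoTotal F E) (σ : Cₛ^∞⟮I; F, E⟯) :
    covec ξ (σ, (0 : C^∞⟮I, Q; 𝓘(ℝ, ℝ), ℝ⟯)) =
      dif (I.prod 𝓘(ℝ, F →L[ℝ] ℝ)) (linFun σ) ξ := by
  simp [covec]

theorem covec_base (ξ : CoTotal F E) (f : C^∞⟮I, Q; 𝓘(ℝ, ℝ), ℝ⟯) :
    covec ξ ((0 : Cₛ^∞⟮I; F, E⟯), f) =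
      dif (I.prod 𝓘(ℝ, F →L[ℝ] ℝ)) (fun ξ : CoTotal F E => f ξ.1) ξ := by
  have h : covec (I := I) ξ ((0 : Cₛ^∞⟮I; F, E⟯), 0) = 0 := map_zero _
  rw [covec_lin] at h
  rw [covec_apply, h, zero_add]

/-- Basic functions are constant along fibres, so the vertical part of the covector sees only the
value of `σ` at the base point. -/
theorem covec_vertVec (ξ : CoTotal F E) (σ : Cₛ^∞⟮I; F, E⟯) (f : C^∞⟮I, Q; 𝓘(ℝ, ℝ), ℝ⟯)
    (η : CoFiber E ξ.1) : covec ξ (σ, f) (vertVec (EQ := EQ) (F := F) η) = η (σ ξ.1) := by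
  have h := dif_base f ξ (vertVec (EQ := EQ) (F := F) η)
  have h0 : dif I f ξ.1 (vertVec (EQ := EQ) (F := F) η).1 = 0 := map_zero _
  have h1 := dif_linFun_vertVec σ ξ η
  calc covec ξ (σ, f) (vertVec (EQ := EQ) (F := F) η)
      = dif (I.prod 𝓘(ℝ, F →L[ℝ] ℝ)) (linFun σ) ξ (vertVec (EQ := EQ) (F := F) η)
        + dif (I.prod 𝓘(ℝ, F →L[ℝ] ℝ)) (fun ξ : CoTotal F E => f ξ.1) ξ
          (vertVec (EQ := EQ) (F := F) η) := rfl
    _ = η (σ ξ.1) := by rw [h, h0, h1, add_zero]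

variable [FiniteDimensional ℝ EQ] [T2Space Q]

/-- A covector on `E*` is determined up to the differential of a basic function by its restriction
to the vertical vectors. -/
theorem exists_eq_covec_of_vertVec {ξ : CoTotal F E} {σ : Cₛ^∞⟮I; F, E⟯}
    {θ : TangentSpace (I.prod 𝓘(ℝ, F →L[ℝ] ℝ)) ξ →L[ℝ] ℝ}
    (h : ∀ η : CoFiber E ξ.1, θ (vertVec (EQ := EQ) (F := F) η) = η (σ ξ.1)) :
    ∃ f : C^∞⟮I, Q; 𝓘(ℝ, ℝ), ℝ⟯, θ = covec ξ (σ, f) := by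
  -- Removing `d σ̂` leaves a covector that kills vertical vectors, hence one that factors through
  -- the base coordinate. The function `f` realizes it.
  let θ' : EQ × (F →L[ℝ] ℝ) →L[ℝ] ℝ := θ - covec ξ (σ, (0 : C^∞⟮I, Q; 𝓘(ℝ, ℝ), ℝ⟯))
  obtain ⟨f, hf⟩ := exists_dif_eq (I := I) ξ.1
    (θ'.comp (ContinuousLinearMap.inl ℝ EQ (F →L[ℝ] ℝ)))
  refine ⟨f, ?_⟩
  have h0 : ∀ w, θ' (0, w) = 0 := fun w => by
    obtain ⟨η, hη⟩ := vertVec_surjective (EQ := EQ) (E := E) (q := ξ.1) w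
    rw [← hη]
    change θ _ - covec ξ (σ, (0 : C^∞⟮I, Q; 𝓘(ℝ, ℝ), ℝ⟯)) _ = 0
    rw [h, covec_vertVec, sub_self]
  have h1 : covec ξ (σ, f) = covec ξ (σ, (0 : C^∞⟮I, Q; 𝓘(ℝ, ℝ), ℝ⟯))
      + dif (I.prod 𝓘(ℝ, F →L[ℝ] ℝ)) (fun ξ : CoTotal F E => f ξ.1) ξ := by
    rw [covec_lin, covec_apply]
  refine ContinuousLinearMap.ext fun w => ?_
  have h2 : θ' w = θ' ((w : EQ × (F →L[ℝ] ℝ)).1, 0) := by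
    have h3 : ∀ w : EQ × (F →L[ℝ] ℝ), θ' w = θ' (w.1, 0) := fun w => by
      have h4 : w = (w.1, 0) + (0, w.2) := by simp
      have h5 := map_add θ' (w.1, 0) (0, w.2)
      rwa [← h4, h0, add_zero] at h5
    exact h3 w
  have h3 : dif (I.prod 𝓘(ℝ, F →L[ℝ] ℝ)) (fun ξ : CoTotal F E => f ξ.1) ξ w = θ' w := by
    rw [h2, dif_base f ξ w, hf]
    rfl
  rw [h1]
  change θ w = covec ξ (σ, (0 : C^∞⟮I, Q; 𝓘(ℝ, ℝ), ℝ⟯)) w +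
    dif (I.prod 𝓘(ℝ, F →L[ℝ] ℝ)) (fun ξ : CoTotal F E => f ξ.1) ξ w
  rw [h3]
  exact (add_sub_cancel _ (θ w)).symm

variable [FiniteDimensional ℝ F] [ContMDiffVectorBundle ∞ F E I]
  [∀ q, IsTopologicalAddGroup (E q)] [∀ q, ContinuousSMul ℝ (E q)]

/-- The differentials of linear and basic functions span the cotangent spaces of `E*`. -/
theorem covec_surjective (ξ : CoTotal F E) : Function.Surjective (covec (I := I) ξ) := by
  intro θ
  have h1 : FiniteDimensional ℝ (E ξ.1) := VectorBundle.finiteDimensional ℝ F E ξ.1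
  have h2 : T2Space (E ξ.1) := FiberBundle.t2Space F E ξ.1
  have hq := FiberBundle.mem_baseSet_trivializationAt (F →L[ℝ] ℝ) (CoFiber E) ξ.1
  let e := (trivializationAt (F →L[ℝ] ℝ) (CoFiber E) ξ.1).continuousLinearEquivAt ℝ ξ.1 hq
  let c : (E ξ.1 →ₗ[ℝ] ℝ) ≃ₗ[ℝ] (E ξ.1 →L[ℝ] ℝ) := LinearMap.toContinuousLinearMap
  let θc : (EQ × (F →L[ℝ] ℝ)) →L[ℝ] ℝ := θ
  let θv : (EQ × (F →L[ℝ] ℝ)) →ₗ[ℝ] ℝ := θc.toLinearMap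
  -- The vertical part of `θ` is a linear functional on the dual of the fibre. By reflexivity in
  -- finite dimension it is evaluation at a vector, which extends to a section `σ`.
  let L : Module.Dual ℝ (Module.Dual ℝ (E ξ.1)) :=
    θv ∘ₗ LinearMap.inr ℝ EQ (F →L[ℝ] ℝ) ∘ₗ (e : CoFiber E ξ.1 →ₗ[ℝ] (F →L[ℝ] ℝ)) ∘ₗ
      (c : Module.Dual ℝ (E ξ.1) →ₗ[ℝ] CoFiber E ξ.1)
  obtain ⟨σ, hσ⟩ := exists_section_eq (I := I) (F := F) ξ.1 ((Module.evalEquiv ℝ (E ξ.1)).symm L)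
  have hL : ∀ η : CoFiber E ξ.1, θ (vertVec (EQ := EQ) (F := F) η) = η (σ ξ.1) := fun η => by
    have h3 : L (c.symm η) = (c.symm η) (σ ξ.1) := by
      rw [hσ]
      exact (Module.apply_evalEquiv_symm_apply (R := ℝ) (M := E ξ.1) (c.symm η) L).symm
    have h4 : L (c.symm η) = θv (vertVec (EQ := EQ) (F := F) (c (c.symm η))) := rfl
    rw [c.apply_symm_apply] at h4
    exact h4.symm.trans h3
  obtain ⟨f, hf⟩ := exists_eq_covec_of_vertVec hL
  exact ⟨(σ, f), hf.symm⟩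

end DualBundle

/-! ### Existence and uniqueness of the linear almost Poisson bivector -/

section LinearPoisson

variable {EQ : Type*} [NormedAddCommGroup EQ] [NormedSpace ℝ EQ]
  {HQ : Type*} [TopologicalSpace HQ] {I : ModelWithCorners ℝ EQ HQ}
  {Q : Type*} [TopologicalSpace Q] [ChartedSpace HQ Q] [IsManifold I ∞ Q]
  {F : Type*} [NormedAddCommGroup F] [NormedSpace ℝ F]
  {E : Q → Type*} [TopologicalSpace (TotalSpace F E)] [∀ q, TopologicalSpace (E q)]
  [∀ q, AddCommGroup (E q)] [∀ q, Module ℝ (E q)] [FiberBundle F E] [VectorBundle ℝ F E]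
  (A : SkewAlgebroid I F E)

namespace SkewAlgebroid

/-- The linear almost Poisson bracket at a point of `E*` of two functions of the form
`σ̂ + f ∘ τ`. -/
def poissonForm (ξ : CoTotal F E) :
    (Cₛ^∞⟮I; F, E⟯ × C^∞⟮I, Q; 𝓘(ℝ, ℝ), ℝ⟯) →ₗ[ℝ]
      (Cₛ^∞⟮I; F, E⟯ × C^∞⟮I, Q; 𝓘(ℝ, ℝ), ℝ⟯) →ₗ[ℝ] ℝ :=
  LinearMap.mk₂ ℝ
    (fun x y => -ξ.2 (A.bracket x.1 y.1 ξ.1) + anchorDeriv A.anchor y.1 x.2 ξ.1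
      - anchorDeriv A.anchor x.1 y.2 ξ.1)
    (fun x x' y => by
      have h1 := anchorDeriv_add_left A.anchor x.1 x'.1 y.2 ξ.1
      have h2 := anchorDeriv_add_right A.anchor y.1 x.2 x'.2 ξ.1
      have h3 : ξ.2 (A.bracket (x + x').1 y.1 ξ.1) =
          ξ.2 (A.bracket x.1 y.1 ξ.1) + ξ.2 (A.bracket x'.1 y.1 ξ.1) := by
        exact (congrArg (fun s : Cₛ^∞⟮I; F, E⟯ => ξ.2 (s ξ.1))
          (A.bracket.map_add₂ x.1 x'.1 y.1)).trans (map_add ξ.2 _ _)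
      change -_ + anchorDeriv A.anchor y.1 (fun q => x.2 q + x'.2 q) ξ.1
        - anchorDeriv A.anchor (x.1 + x'.1) y.2 ξ.1 = _
      rw [h1, h2, h3]
      ring)
    (fun c x y => by
      have h1 := anchorDeriv_smul_left A.anchor c x.1 y.2 ξ.1
      have h2 := anchorDeriv_smul_right A.anchor y.1 c x.2 ξ.1
      have h3 : ξ.2 (A.bracket (c • x).1 y.1 ξ.1) = c * ξ.2 (A.bracket x.1 y.1 ξ.1) := by
        exact (congrArg (fun s : Cₛ^∞⟮I; F, E⟯ => ξ.2 (s ξ.1))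
          (A.bracket.map_smul₂ c x.1 y.1)).trans (map_smul ξ.2 _ _)
      change -_ + anchorDeriv A.anchor y.1 (fun q => c * x.2 q) ξ.1
        - anchorDeriv A.anchor (c • x.1) y.2 ξ.1 = c * _
      rw [h1, h2, h3]
      ring)
    (fun x y y' => by
      have h1 := anchorDeriv_add_left A.anchor y.1 y'.1 x.2 ξ.1
      have h2 := anchorDeriv_add_right A.anchor x.1 y.2 y'.2 ξ.1
      have h3 : ξ.2 (A.bracket x.1 (y + y').1 ξ.1) =
          ξ.2 (A.bracket x.1 y.1 ξ.1) + ξ.2 (A.bracket x.1 y'.1 ξ.1) := by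
        exact (congrArg (fun s : Cₛ^∞⟮I; F, E⟯ => ξ.2 (s ξ.1))
          ((A.bracket x.1).map_add y.1 y'.1)).trans (map_add ξ.2 _ _)
      change -_ + anchorDeriv A.anchor (y.1 + y'.1) x.2 ξ.1
        - anchorDeriv A.anchor x.1 (fun q => y.2 q + y'.2 q) ξ.1 = _
      rw [h1, h2, h3]
      ring)
    (fun c x y => by
      have h1 := anchorDeriv_smul_left A.anchor c y.1 x.2 ξ.1
      have h2 := anchorDeriv_smul_right A.anchor x.1 c y.2 ξ.1
      have h3 : ξ.2 (A.bracket x.1 (c • y).1 ξ.1) = c * ξ.2 (A.bracket x.1 y.1 ξ.1) := by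
        exact (congrArg (fun s : Cₛ^∞⟮I; F, E⟯ => ξ.2 (s ξ.1))
          ((A.bracket x.1).map_smul c y.1)).trans (map_smul ξ.2 _ _)
      change -_ + anchorDeriv A.anchor (c • y.1) x.2 ξ.1
        - anchorDeriv A.anchor x.1 (fun q => c * y.2 q) ξ.1 = c * _
      rw [h1, h2, h3]
      ring)

theorem poissonForm_apply (ξ : CoTotal F E) (σ γ : Cₛ^∞⟮I; F, E⟯)
    (f g : C^∞⟮I, Q; 𝓘(ℝ, ℝ), ℝ⟯) :
    A.poissonForm ξ (σ, f) (γ, g) = -ξ.2 (A.bracket σ γ ξ.1) + anchorDeriv A.anchor γ f ξ.1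
      - anchorDeriv A.anchor σ g ξ.1 := rfl

theorem poissonForm_skew (ξ : CoTotal F E) (x y : Cₛ^∞⟮I; F, E⟯ × C^∞⟮I, Q; 𝓘(ℝ, ℝ), ℝ⟯) :
    A.poissonForm ξ x y = -A.poissonForm ξ y x := by
  obtain ⟨σ, f⟩ := x
  obtain ⟨γ, g⟩ := y
  have h : ξ.2 (A.bracket σ γ ξ.1) = -ξ.2 (A.bracket γ σ ξ.1) :=
    (congrArg (fun s : Cₛ^∞⟮I; F, E⟯ => ξ.2 (s ξ.1)) (A.skew σ γ)).trans (map_neg ξ.2 _)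
  rw [poissonForm_apply, poissonForm_apply, h]
  ring

theorem anchorDeriv_const (σ : Cₛ^∞⟮I; F, E⟯) (c : ℝ) (q : Q) :
    anchorDeriv A.anchor σ (fun _ => c) q = 0 := by
  have h : dif I (fun _ : Q => c) q = 0 := mfderiv_const
  rw [anchorDeriv, h]
  rfl

theorem poissonForm_lin_lin (ξ : CoTotal F E) (σ γ : Cₛ^∞⟮I; F, E⟯) :
    A.poissonForm ξ (σ, 0) (γ, 0) = -ξ.2 (A.bracket σ γ ξ.1) := by
  have h1 := A.anchorDeriv_const σ 0 ξ.1
  have h2 := A.anchorDeriv_const γ 0 ξ.1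
  change -_ + anchorDeriv A.anchor γ (fun _ => 0) ξ.1
      - anchorDeriv A.anchor σ (fun _ => 0) ξ.1 = _
  rw [h1, h2]
  ring

theorem poissonForm_base_lin (ξ : CoTotal F E) (f : C^∞⟮I, Q; 𝓘(ℝ, ℝ), ℝ⟯)
    (σ : Cₛ^∞⟮I; F, E⟯) :
    A.poissonForm ξ (0, f) (σ, 0) = anchorDeriv A.anchor σ f ξ.1 := by
  have h1 := A.anchorDeriv_const 0 0 ξ.1
  have h2 : ξ.2 (A.bracket 0 σ ξ.1) = 0 := by
    rw [A.bracket.map_zero₂]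
    exact map_zero _
  change -ξ.2 (A.bracket 0 σ ξ.1) + anchorDeriv A.anchor σ f ξ.1
      - anchorDeriv A.anchor 0 (fun _ => 0) ξ.1 = _
  rw [h1, h2]
  ring

theorem poissonForm_base_base (ξ : CoTotal F E) (f g : C^∞⟮I, Q; 𝓘(ℝ, ℝ), ℝ⟯) :
    A.poissonForm ξ (0, f) (0, g) = 0 := by
  have h1 : ∀ f : Q → ℝ, anchorDeriv A.anchor 0 f ξ.1 = 0 := fun f => by
    simp [anchorDeriv]
  have h2 : ξ.2 (A.bracket 0 0 ξ.1) = 0 := by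
    rw [map_zero]
    exact map_zero _
  rw [poissonForm_apply, h1, h1, h2]
  ring

/-- The axioms fix the bivector on the generating covectors. Since these span, this gives
uniqueness, and it is the formula by which every bracket is computed. -/
theorem IsLinearPoisson.apply_covec {A : SkewAlgebroid I F E} {B : BivectorField I F E}
    (hB : A.IsLinearPoisson B) (ξ : CoTotal F E)
    (x y : Cₛ^∞⟮I; F, E⟯ × C^∞⟮I, Q; 𝓘(ℝ, ℝ), ℝ⟯) :
    B ξ (covec ξ x) (covec ξ y) = A.poissonForm ξ x y := by
  obtain ⟨σ, f⟩ := x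
  obtain ⟨γ, g⟩ := y
  have h1 := congrFun (hB.lin_lin σ γ) ξ
  have h2 := congrFun (hB.base_lin f γ) ξ
  have h3 := congrFun (hB.base_lin g σ) ξ
  have h4 := congrFun (hB.base_base f g) ξ
  simp only [BivectorField.poisson, Pi.neg_apply, Pi.zero_apply] at h1 h2 h3 h4
  rw [hB.skew] at h3
  rw [covec_apply, covec_apply, map_add, map_add, LinearMap.add_apply, LinearMap.add_apply,
    h1, h2, h4, poissonForm_apply, linFun]
  linarith

variable [FiniteDimensional ℝ EQ] [T2Space Q] [FiniteDimensional ℝ F]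
  [ContMDiffVectorBundle ∞ F E I]

/-- If a section `δ` vanishes at `q` then `ξ([γ, δ](q))` is the derivative of `δ̂` at `ξ` along
any vector over `ρ(γ(q))`. -/
theorem apply_bracket_of_eq_zero (ξ : CoTotal F E) (γ : Cₛ^∞⟮I; F, E⟯) {δ : Cₛ^∞⟮I; F, E⟯}
    (hδ : δ ξ.1 = 0) (w : EQ × (F →L[ℝ] ℝ)) (hw : w.1 = A.anchor ξ.1 (γ ξ.1)) :
    ξ.2 (A.bracket γ δ ξ.1) = dif (I.prod 𝓘(ℝ, F →L[ℝ] ℝ)) (linFun δ) ξ w := by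
  -- Both sides are additive in `δ`, which reduces the claim to `δ = g σ` with `g` vanishing at the
  -- base point. There the Leibniz rule on the left and the product rule on the right both leave the
  -- derivative of `g` along `ρ(γ)` times `ξ(σ)`.
  refine section_induction_of_eq_zero
    (P := fun δ => ξ.2 (A.bracket γ δ ξ.1) = dif (I.prod 𝓘(ℝ, F →L[ℝ] ℝ)) (linFun δ) ξ w)
    ?_ ?_ ?_ hδ
  · have h := covec_lin ξ (0 : Cₛ^∞⟮I; F, E⟯)
    rw [← h, ← Prod.zero_eq_mk, map_zero, map_zero]
    exact map_zero _
  · intro σ τ hσ hτ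
    have h : dif (I.prod 𝓘(ℝ, F →L[ℝ] ℝ)) (linFun (σ + τ)) ξ =
        dif (I.prod 𝓘(ℝ, F →L[ℝ] ℝ)) (linFun σ) ξ
          + dif (I.prod 𝓘(ℝ, F →L[ℝ] ℝ)) (linFun τ) ξ := by
      rw [← covec_lin, ← covec_lin, ← covec_lin, ← map_add]
      congr 1
      simp
    rw [h]
    change _ = dif (I.prod 𝓘(ℝ, F →L[ℝ] ℝ)) (linFun σ) ξ w
      + dif (I.prod 𝓘(ℝ, F →L[ℝ] ℝ)) (linFun τ) ξ w
    rw [← hσ, ← hτ]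
    exact (congrArg (fun s : Cₛ^∞⟮I; F, E⟯ => ξ.2 (s ξ.1))
      ((A.bracket γ).map_add σ τ)).trans (map_add ξ.2 _ _)
  · intro g σ hg
    have h1 := A.leibniz γ σ g ξ.1
    rw [hg, zero_smul, zero_add] at h1
    have h2 := (HasMFDerivAt.mul (mdiff_base g ξ).hasMFDerivAt
      (mdiff_linFun σ ξ).hasMFDerivAt).mfderiv
    have h3 : linFun (funSmul g σ) = (fun ξ : CoTotal F E => g ξ.1) * linFun σ :=
      funext fun ξ => map_smul ξ.2 _ _
    have h4 : dif (I.prod 𝓘(ℝ, F →L[ℝ] ℝ)) (linFun (funSmul g σ)) ξ w =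
        g ξ.1 * dif (I.prod 𝓘(ℝ, F →L[ℝ] ℝ)) (linFun σ) ξ w + linFun σ ξ *
          dif (I.prod 𝓘(ℝ, F →L[ℝ] ℝ)) (fun ξ : CoTotal F E => g ξ.1) ξ w := by
      rw [h3]
      exact congrArg (fun L => L w) h2
    rw [h4, hg, h1, map_smul, dif_base g ξ w, hw, smul_eq_mul, anchorDeriv, linFun]
    ring

/-- This makes the form descend to the cotangent space. Evaluating `d δ̂ + d(f ∘ τ) = 0` on vertical
vectors gives `δ = 0` at the base point. Evaluating it on a vector over `ρ(γ)` shows that the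
bracket term and the term `ρ(γ)(f)` cancel. -/
theorem poissonForm_eq_zero_of_covec {ξ : CoTotal F E}
    {x : Cₛ^∞⟮I; F, E⟯ × C^∞⟮I, Q; 𝓘(ℝ, ℝ), ℝ⟯} (hx : covec ξ x = 0)
    [∀ q, IsTopologicalAddGroup (E q)] [∀ q, ContinuousSMul ℝ (E q)]
    (y : Cₛ^∞⟮I; F, E⟯ × C^∞⟮I, Q; 𝓘(ℝ, ℝ), ℝ⟯) : A.poissonForm ξ y x = 0 := by
  obtain ⟨δ, f⟩ := x
  obtain ⟨γ, g⟩ := y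
  have hδ : δ ξ.1 = 0 := by
    have h1 : FiniteDimensional ℝ (E ξ.1) := VectorBundle.finiteDimensional ℝ F E ξ.1
    have h2 : T2Space (E ξ.1) := FiberBundle.t2Space F E ξ.1
    rw [← Module.forall_dual_apply_eq_zero_iff ℝ]
    intro η
    have h3 := covec_vertVec ξ δ f (LinearMap.toContinuousLinearMap η)
    rw [hx] at h3
    exact h3.symm
  have h1 := A.apply_bracket_of_eq_zero ξ γ hδ (A.anchor ξ.1 (γ ξ.1), 0) rfl
  have h2 := congrArg (fun L : TangentSpace (I.prod 𝓘(ℝ, F →L[ℝ] ℝ)) ξ →L[ℝ] ℝ =>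
    L ((A.anchor ξ.1 (γ ξ.1), 0) : EQ × (F →L[ℝ] ℝ))) hx
  have h3 := dif_base f ξ (A.anchor ξ.1 (γ ξ.1), 0)
  have h4 : dif (I.prod 𝓘(ℝ, F →L[ℝ] ℝ)) (linFun δ) ξ
      ((A.anchor ξ.1 (γ ξ.1), 0) : EQ × (F →L[ℝ] ℝ))
      + dif (I.prod 𝓘(ℝ, F →L[ℝ] ℝ)) (fun ξ : CoTotal F E => f ξ.1) ξ
        ((A.anchor ξ.1 (γ ξ.1), 0) : EQ × (F →L[ℝ] ℝ)) = 0 := h2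
  rw [← h1, h3] at h4
  have h5 : anchorDeriv A.anchor δ g ξ.1 = 0 := by
    rw [anchorDeriv, hδ, map_zero, map_zero]
  rw [poissonForm_apply, h5, anchorDeriv]
  simp only at h4
  linarith

variable [∀ q, IsTopologicalAddGroup (E q)] [∀ q, ContinuousSMul ℝ (E q)]

theorem exists_isLinearPoisson : ∃ B : BivectorField I F E, A.IsLinearPoisson B := by
  have hs : ∀ ξ : CoTotal F E, ∃ s, covec (I := I) ξ ∘ₗ s = LinearMap.id := fun ξ =>
    LinearMap.exists_rightInverse_of_surjective _ (LinearMap.range_eq_top.2 (covec_surjective ξ))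
  choose s hs using hs
  -- A linear right inverse of `covec ξ` transports the form. The choice is immaterial: two lifts of
  -- a covector differ by an element of the kernel of `covec ξ`, which the form annihilates in its
  -- second argument and, by skew-symmetry, in its first.
  let B : BivectorField I F E := fun ξ => (A.poissonForm ξ).compl₁₂ (s ξ) (s ξ)
  have hker : ∀ ξ x, covec ξ (s ξ (covec ξ x) - x) = 0 := fun ξ x => by
    have := LinearMap.congr_fun (hs ξ) (covec ξ x)
    rw [map_sub, sub_eq_zero]
    exact this
  have hright : ∀ ξ x y, A.poissonForm ξ x (s ξ (covec ξ y)) = A.poissonForm ξ x y :=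
    fun ξ x y => by
      have := A.poissonForm_eq_zero_of_covec (hker ξ y) x
      rwa [map_sub, sub_eq_zero] at this
  have hB : ∀ ξ x y, B ξ (covec ξ x) (covec ξ y) = A.poissonForm ξ x y := fun ξ x y => by
    change A.poissonForm ξ (s ξ (covec ξ x)) (s ξ (covec ξ y)) = _
    rw [hright, A.poissonForm_skew, hright, ← A.poissonForm_skew]
  refine ⟨B, ⟨fun ξ η θ => A.poissonForm_skew ξ _ _, fun σ γ => funext fun ξ => ?_,
    fun f σ => funext fun ξ => ?_, fun f g => funext fun ξ => ?_⟩⟩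
  · rw [BivectorField.poisson, ← covec_lin, ← covec_lin, hB]
    exact A.poissonForm_lin_lin ξ σ γ
  · rw [BivectorField.poisson, ← covec_lin, ← covec_base, hB]
    exact A.poissonForm_base_lin ξ f σ
  · rw [BivectorField.poisson, ← covec_base, ← covec_base, hB]
    exact A.poissonForm_base_base ξ f g

theorem existsUnique_isLinearPoisson : ∃! B : BivectorField I F E, A.IsLinearPoisson B := by
  obtain ⟨B, hB⟩ := A.exists_isLinearPoisson
  refine ⟨B, hB, fun B' hB' => funext fun ξ => LinearMap.ext fun θ => LinearMap.ext fun θ' => ?_⟩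
  obtain ⟨x, rfl⟩ := covec_surjective (I := I) ξ θ
  obtain ⟨y, rfl⟩ := covec_surjective (I := I) ξ θ'
  rw [hB.apply_covec, hB'.apply_covec]

theorem isLinearPoisson_bivector : A.IsLinearPoisson A.bivector :=
  Classical.epsilon_spec A.exists_isLinearPoisson

end SkewAlgebroid

end LinearPoisson

/-! ### The Hamiltonian vector field and the Hamilton-Jacobi equation -/

section MechanicalSystem

variable {EQ : Type*} [NormedAddCommGroup EQ] [NormedSpace ℝ EQ]
  {HQ : Type*} [TopologicalSpace HQ] {I : ModelWithCorners ℝ EQ HQ}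
  {Q : Type*} [TopologicalSpace Q] [ChartedSpace HQ Q] [IsManifold I ∞ Q]
  {F : Type*} [NormedAddCommGroup F] [NormedSpace ℝ F] [FiniteDimensional ℝ F]
  {E : Q → Type*} [TopologicalSpace (TotalSpace F E)] [∀ q, TopologicalSpace (E q)]
  [∀ q, AddCommGroup (E q)] [∀ q, Module ℝ (E q)] [FiberBundle F E] [VectorBundle ℝ F E]
  [ContMDiffVectorBundle ∞ F E I]
  [∀ q, IsTopologicalAddGroup (E q)] [∀ q, ContinuousSMul ℝ (E q)]
  {FU : Type*} [NormedAddCommGroup FU] [NormedSpace ℝ FU] [FiniteDimensional ℝ FU]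
  {U : Q → Type*} [TopologicalSpace (TotalSpace FU U)] [∀ q, TopologicalSpace (U q)]
  [∀ q, AddCommGroup (U q)] [∀ q, Module ℝ (U q)] [FiberBundle FU U] [VectorBundle ℝ FU U]
  [ContMDiffVectorBundle ∞ FU U I]
  [∀ q, IsTopologicalAddGroup (U q)] [∀ q, ContinuousSMul ℝ (U q)]

namespace AffineSystem

variable (I) in
theorem contMDiff_mu :
    ContMDiff (I.prod 𝓘(ℝ, ℝ × FU →L[ℝ] ℝ)) (I.prod 𝓘(ℝ, FU →L[ℝ] ℝ)) ∞
      (mu : CoTotal (ℝ × FU) (Bidual U) → CoTotal FU U) := by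
  let φ : ∀ q : Q, CoFiber (Bidual U) q →L[ℝ] CoFiber U q := fun q =>
    ContinuousLinearMap.precomp ℝ (ContinuousLinearMap.inr ℝ ℝ (U q))
  have hφ : ContMDiff I (I.prod 𝓘(ℝ, (ℝ × FU →L[ℝ] ℝ) →L[ℝ] (FU →L[ℝ] ℝ))) ∞
      (fun q => TotalSpace.mk' ((ℝ × FU →L[ℝ] ℝ) →L[ℝ] (FU →L[ℝ] ℝ))
        (E := fun q => CoFiber (Bidual U) q →L[ℝ] CoFiber U q) q (φ q)) :=
    contMDiff_hom_of_sections (F := ℝ × FU →L[ℝ] ℝ) (E := CoFiber (Bidual U))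
      (F' := FU →L[ℝ] ℝ) (E' := CoFiber U) fun q₀ σ hσ =>
      contMDiffAt_hom_of_sections (F := FU) (E := U) (F' := ℝ) (E' := Trivial Q ℝ)
        (φ := fun q => muFib q (σ q))
        fun _ hw => ContMDiffAt.clm_bundle_apply (F₁ := ℝ × FU) (E₁ := Bidual U) (F₂ := ℝ)
          (E₂ := Trivial Q ℝ) hσ (contMDiffAt_prod_section.2 ⟨contMDiffAt_const, hw⟩)
  exact ContMDiff.clm_bundle_apply (F₁ := ℝ × FU →L[ℝ] ℝ) (E₁ := CoFiber (Bidual U))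
    (F₂ := FU →L[ℝ] ℝ) (E₂ := CoFiber U) (b := fun ξ : CoTotal (ℝ × FU) (Bidual U) => ξ.1)
    (ϕ := fun ξ => φ ξ.1) (v := fun ξ => ξ.2) (hφ.comp (contMDiff_proj _)) contMDiff_id

variable (I) in
theorem mdiff_mu (ξ : CoTotal (ℝ × FU) (Bidual U)) :
    MDifferentiableAt (I.prod 𝓘(ℝ, ℝ × FU →L[ℝ] ℝ)) (I.prod 𝓘(ℝ, FU →L[ℝ] ℝ))
      (mu : CoTotal (ℝ × FU) (Bidual U) → CoTotal FU U) ξ :=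
  (contMDiff_mu I).mdifferentiable (by simp) ξ

theorem mu_surjective :
    Function.Surjective (mu : CoTotal (ℝ × FU) (Bidual U) → CoTotal FU U) := fun η =>
  ⟨⟨η.1, η.2.comp (ContinuousLinearMap.snd ℝ ℝ (U η.1))⟩, rfl⟩

theorem dif_comp_mu {G : CoTotal FU U → ℝ} {ξ : CoTotal (ℝ × FU) (Bidual U)}
    (hG : MDifferentiableAt (I.prod 𝓘(ℝ, FU →L[ℝ] ℝ)) 𝓘(ℝ, ℝ) G (mu ξ)) :
    dif (I.prod 𝓘(ℝ, ℝ × FU →L[ℝ] ℝ)) (fun ξ => G (mu ξ)) ξ =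
      (dif (I.prod 𝓘(ℝ, FU →L[ℝ] ℝ)) G (mu ξ)).comp
        (mfderiv (I.prod 𝓘(ℝ, ℝ × FU →L[ℝ] ℝ)) (I.prod 𝓘(ℝ, FU →L[ℝ] ℝ)) mu ξ) :=
  mfderiv_comp ξ hG (mdiff_mu I ξ)

/-- The map `μ` is dual to the inclusion of `U` and covers the identity of `Q`: hence `σ̂ ∘ μ` is
the linear function of `(0, σ)`, and basic functions pull back to basic functions. -/
theorem covec_comp_mfderiv_mu (ξ : CoTotal (ℝ × FU) (Bidual U)) (σ : Cₛ^∞⟮I; FU, U⟯)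
    (k : C^∞⟮I, Q; 𝓘(ℝ, ℝ), ℝ⟯) :
    (covec (mu ξ) (σ, k)).comp
        (mfderiv (I.prod 𝓘(ℝ, ℝ × FU →L[ℝ] ℝ)) (I.prod 𝓘(ℝ, FU →L[ℝ] ℝ)) mu ξ) =
      covec ξ (mapSec kerIncl σ, k) := by
  have h1 := dif_comp_mu (mdiff_linFun σ (mu ξ))
  have h2 := dif_comp_mu (mdiff_base (F := FU) (E := U) k (mu ξ))
  rw [covec_apply, covec_apply, ContinuousLinearMap.add_comp, ← h1, ← h2]
  rfl

variable (S : AffineSystem I F E FU U)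

theorem contMDiff_hamiltonian :
    ContMDiff (I.prod 𝓘(ℝ, FU →L[ℝ] ℝ)) 𝓘(ℝ, ℝ) ∞ S.hamiltonian := by
  have h1 : ContMDiff (I.prod 𝓘(ℝ, FU →L[ℝ] ℝ)) (I.prod 𝓘(ℝ, FU)) ∞
      (fun η : CoTotal FU U => TotalSpace.mk' FU η.1 (S.sharpHom η.1 η.2)) :=
    ContMDiff.clm_bundle_apply (F₁ := FU →L[ℝ] ℝ) (E₁ := CoFiber U)
      (b := fun η : CoTotal FU U => η.1) (ϕ := fun η => S.sharpHom η.1) (v := fun η => η.2)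
      (S.sharpHom.contMDiff.comp (contMDiff_proj _)) contMDiff_id
  have h2 := ContMDiff.clm_bundle_apply (F₁ := FU) (F₂ := ℝ) (E₁ := U) (E₂ := Trivial Q ℝ)
    (b := fun η : CoTotal FU U => η.1) (ϕ := fun η => η.2) contMDiff_id h1
  have h3 : ContMDiff (I.prod 𝓘(ℝ, FU →L[ℝ] ℝ)) 𝓘(ℝ, ℝ) ∞
      (fun η : CoTotal FU U => η.2 (S.sharpHom η.1 η.2)) :=
    fun η => (contMDiffAt_totalSpace.1 (h2 η)).2
  have h4 : ContMDiff (I.prod 𝓘(ℝ, FU →L[ℝ] ℝ)) 𝓘(ℝ, ℝ) ∞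
      (fun η : CoTotal FU U => S.potential η.1) :=
    S.potential.contMDiff.comp (contMDiff_proj (CoFiber U))
  exact (contMDiff_const.mul h3).add h4

theorem mdiff_hamiltonian (η : CoTotal FU U) :
    MDifferentiableAt (I.prod 𝓘(ℝ, FU →L[ℝ] ℝ)) 𝓘(ℝ, ℝ) S.hamiltonian η :=
  S.contMDiff_hamiltonian.mdifferentiable (by simp) η

/-- The pair `(1, 0)` stands for `(1, X₀)`, on which `h(η)` takes the value `-H(η)`; this turns the
subtraction of `h ∘ μ` into the addition of `H ∘ μ`. -/
theorem funH_eq :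
    S.funH = fun ξ => linFun (oneX₀ : Cₛ^∞⟮I; ℝ × FU, Bidual U⟯) ξ + S.hamiltonian (mu ξ) := by
  funext ξ
  change ξ.2 (1, 0) - S.hamFib ξ.1 (muFib ξ.1 ξ.2) (1, 0) = ξ.2 (1, 0) + S.hamiltonian (mu ξ)
  rw [hamFib_apply, map_zero, one_mul, zero_sub, sub_neg_eq_add]
  rfl

theorem dif_funH {ξ : CoTotal (ℝ × FU) (Bidual U)} {γ : Cₛ^∞⟮I; FU, U⟯}
    {f : C^∞⟮I, Q; 𝓘(ℝ, ℝ), ℝ⟯}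
    (h : dif (I.prod 𝓘(ℝ, FU →L[ℝ] ℝ)) S.hamiltonian (mu ξ) = covec (mu ξ) (γ, f)) :
    dif (I.prod 𝓘(ℝ, ℝ × FU →L[ℝ] ℝ)) S.funH ξ = covec ξ (oneX₀ + mapSec kerIncl γ, f) := by
  have h1 := mfderiv_add (mdiff_linFun (oneX₀ : Cₛ^∞⟮I; ℝ × FU, Bidual U⟯) ξ)
    ((S.mdiff_hamiltonian (mu ξ)).comp ξ (mdiff_mu I ξ))
  have h2 := dif_comp_mu (S.mdiff_hamiltonian (mu ξ))
  rw [h, covec_comp_mfderiv_mu] at h2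
  have h3 : covec ξ (oneX₀ + mapSec kerIncl γ, f) =
      covec ξ (oneX₀, (0 : C^∞⟮I, Q; 𝓘(ℝ, ℝ), ℝ⟯)) + covec ξ (mapSec kerIncl γ, f) := by
    rw [← map_add, Prod.mk_add_mk, zero_add]
  rw [h3, covec_lin, ← h2, funH_eq]
  exact h1

variable (A : LieAlgebroid I F E)

theorem mapSec_bidualIncl_kerIncl (σ : Cₛ^∞⟮I; FU, U⟯) :
    mapSec S.bidualIncl (mapSec kerIncl σ) = pairSec 0 (mapSec S.incl σ) := by
  refine ContMDiffSection.ext fun q => ?_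
  change S.bidualIncl q (0, σ q) = (0, S.incl q (σ q))
  rw [bidualIncl_apply, zero_smul, zero_add]

theorem mapSec_bidualIncl_oneX₀_add (γ : Cₛ^∞⟮I; FU, U⟯) :
    mapSec S.bidualIncl (oneX₀ + mapSec kerIncl γ) = pairSec 1 (S.X₀ + mapSec S.incl γ) := by
  refine ContMDiffSection.ext fun q => ?_
  change S.bidualIncl q (1 + 0, 0 + γ q) = (1, S.X₀ q + S.incl q (γ q))
  rw [bidualIncl_apply, add_zero, zero_add, one_smul]

/-- The real components of the two sections are the constants `0` and `1`, whose derivatives vanish,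
so the bracket has real component `0`. Its linear function on `𝒰⁺` therefore factors through `μ`. -/
theorem bidual_bracket (σ γ : Cₛ^∞⟮I; FU, U⟯) :
    (S.bidualAlgebroid A).bracket (mapSec kerIncl σ) (oneX₀ + mapSec kerIncl γ) =
      mapSec kerIncl (mapSec S.proj
        (A.bracket (mapSec S.incl σ) (S.X₀ + mapSec S.incl γ))) := by
  have h : (S.bidualAlgebroid A).bracket (mapSec kerIncl σ) (oneX₀ + mapSec kerIncl γ) =
      mapSec S.bidualProj (A.toSkewAlgebroid.timesReal.bracket
        (mapSec S.bidualIncl (mapSec kerIncl σ))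
        (mapSec S.bidualIncl (oneX₀ + mapSec kerIncl γ))) := rfl
  rw [h, mapSec_bidualIncl_kerIncl, mapSec_bidualIncl_oneX₀_add]
  refine ContMDiffSection.ext fun q => Prod.ext ?_ rfl
  have h1 := A.toSkewAlgebroid.anchorDeriv_const (mapSec S.incl σ) 1 q
  have h2 := A.toSkewAlgebroid.anchorDeriv_const (S.X₀ + mapSec S.incl γ) 0 q
  change anchorDeriv A.anchor (mapSec S.incl σ) (fun _ => 1) q
    - anchorDeriv A.anchor (S.X₀ + mapSec S.incl γ) (fun _ => 0) q = 0
  rw [h1, h2, sub_zero]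

theorem bidual_anchorDeriv_kerIncl (σ : Cₛ^∞⟮I; FU, U⟯) (f : Q → ℝ) (q : Q) :
    anchorDeriv (S.bidualAlgebroid A).anchor (mapSec kerIncl σ) f q =
      anchorDeriv A.anchor (mapSec S.incl σ) f q := by
  have h := congrArg (fun s => dif I f q (A.anchor q (s q).2)) (S.mapSec_bidualIncl_kerIncl σ)
  exact h

theorem bidual_anchorDeriv_oneX₀_add (γ : Cₛ^∞⟮I; FU, U⟯) (f : Q → ℝ) (q : Q) :
    anchorDeriv (S.bidualAlgebroid A).anchor (oneX₀ + mapSec kerIncl γ) f q =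
      anchorDeriv A.anchor (S.X₀ + mapSec S.incl γ) f q := by
  have h := congrArg (fun s => dif I f q (A.anchor q (s q).2)) (S.mapSec_bidualIncl_oneX₀_add γ)
  exact h

/-- The value `R_h(σ̂ + k ∘ τ)` at `η`, when `dH = d γ̂ + d (f ∘ τ)` at `η`. -/
def hamForm (η : CoTotal FU U) (γ : Cₛ^∞⟮I; FU, U⟯) (f : C^∞⟮I, Q; 𝓘(ℝ, ℝ), ℝ⟯)
    (σ : Cₛ^∞⟮I; FU, U⟯) (k : C^∞⟮I, Q; 𝓘(ℝ, ℝ), ℝ⟯) : ℝ :=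
  -η.2 (S.proj η.1 (A.bracket (mapSec S.incl σ) (S.X₀ + mapSec S.incl γ) η.1))
    + anchorDeriv A.anchor (S.X₀ + mapSec S.incl γ) k η.1
    - anchorDeriv A.anchor (mapSec S.incl σ) f η.1

/-- The right-hand side involves `ξ` only through `μ(ξ)`, as the existence of `R_h` requires. -/
theorem poissonForm_bidual (ξ : CoTotal (ℝ × FU) (Bidual U)) (σ γ : Cₛ^∞⟮I; FU, U⟯)
    (k f : C^∞⟮I, Q; 𝓘(ℝ, ℝ), ℝ⟯) :
    (S.bidualAlgebroid A).poissonForm ξ (mapSec kerIncl σ, k) (oneX₀ + mapSec kerIncl γ, f) =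
      S.hamForm A (mu ξ) γ f σ k := by
  rw [SkewAlgebroid.poissonForm_apply, bidual_bracket, bidual_anchorDeriv_kerIncl,
    bidual_anchorDeriv_oneX₀_add]
  rfl

variable [FiniteDimensional ℝ EQ] [T2Space Q]

theorem poisson_comp_mu_funH {ξ : CoTotal (ℝ × FU) (Bidual U)} {η : CoTotal FU U} (hξ : mu ξ = η)
    {G : CoTotal FU U → ℝ} (hG : MDifferentiableAt (I.prod 𝓘(ℝ, FU →L[ℝ] ℝ)) 𝓘(ℝ, ℝ) G η)
    {σ γ : Cₛ^∞⟮I; FU, U⟯} {k f : C^∞⟮I, Q; 𝓘(ℝ, ℝ), ℝ⟯}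
    (hσ : dif (I.prod 𝓘(ℝ, FU →L[ℝ] ℝ)) G η = covec η (σ, k))
    (hγ : dif (I.prod 𝓘(ℝ, FU →L[ℝ] ℝ)) S.hamiltonian η = covec η (γ, f)) :
    (S.bidualAlgebroid A).bivector.poisson (fun ξ => G (mu ξ)) S.funH ξ =
      S.hamForm A η γ f σ k := by
  subst hξ
  rw [BivectorField.poisson, S.dif_funH hγ, dif_comp_mu hG, hσ, covec_comp_mfderiv_mu,
    (S.bidualAlgebroid A).isLinearPoisson_bivector.apply_covec, poissonForm_bidual]

theorem exists_isHamiltonianField : ∃ R, S.IsHamiltonianField A R := by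
  have key : ∀ η : CoTotal FU U, ∃ v : TangentSpace (I.prod 𝓘(ℝ, FU →L[ℝ] ℝ)) η,
      ∀ (G : C^∞⟮I.prod 𝓘(ℝ, FU →L[ℝ] ℝ), CoTotal FU U; 𝓘(ℝ, ℝ), ℝ⟯)
        (ξ : CoTotal (ℝ × FU) (Bidual U)), mu ξ = η →
        dif (I.prod 𝓘(ℝ, FU →L[ℝ] ℝ)) G η v =
          (S.bidualAlgebroid A).bivector.poisson (fun ξ => G (mu ξ)) S.funH ξ := by
    intro η
    obtain ⟨ξ₀, rfl⟩ := mu_surjective η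
    let T := EQ × (FU →L[ℝ] ℝ)
    let c : (T →ₗ[ℝ] ℝ) ≃ₗ[ℝ] (T →L[ℝ] ℝ) := LinearMap.toContinuousLinearMap
    let m := mfderiv (I.prod 𝓘(ℝ, ℝ × FU →L[ℝ] ℝ)) (I.prod 𝓘(ℝ, FU →L[ℝ] ℝ)) mu ξ₀
    let pull : (TangentSpace (I.prod 𝓘(ℝ, FU →L[ℝ] ℝ)) (mu ξ₀) →L[ℝ] ℝ) →ₗ[ℝ]
        (TangentSpace (I.prod 𝓘(ℝ, ℝ × FU →L[ℝ] ℝ)) ξ₀ →L[ℝ] ℝ) :=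
      { toFun := fun θ => θ.comp m
        map_add' := fun θ θ' => ContinuousLinearMap.add_comp _ _ _
        map_smul' := fun c θ => ContinuousLinearMap.smul_comp _ _ _ }
    -- At a fixed preimage `ξ₀`, the bracket `{G ∘ μ, F_h}` is linear in `dG`, so by reflexivity in
    -- finite dimension it is evaluation of `dG` at a tangent vector.
    let L' : (T →L[ℝ] ℝ) →ₗ[ℝ] ℝ :=
      (((S.bidualAlgebroid A).bivector ξ₀).flip
        (dif (I.prod 𝓘(ℝ, ℝ × FU →L[ℝ] ℝ)) S.funH ξ₀)) ∘ₗ pull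
    let L : Module.Dual ℝ (Module.Dual ℝ T) := L' ∘ₗ (c : (T →ₗ[ℝ] ℝ) →ₗ[ℝ] (T →L[ℝ] ℝ))
    refine ⟨(Module.evalEquiv ℝ T).symm L, fun G ξ hξ => ?_⟩
    have hG : ∀ η, MDifferentiableAt (I.prod 𝓘(ℝ, FU →L[ℝ] ℝ)) 𝓘(ℝ, ℝ) G η :=
      G.contMDiff.mdifferentiable (by simp)
    -- Independence of the preimage: both brackets equal the same `hamForm` at `mu ξ₀`.
    have h1 : (S.bidualAlgebroid A).bivector.poisson (fun ξ => G (mu ξ)) S.funH ξ =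
        (S.bidualAlgebroid A).bivector.poisson (fun ξ => G (mu ξ)) S.funH ξ₀ := by
      obtain ⟨⟨σ, k⟩, hσ⟩ := covec_surjective (I := I) (mu ξ₀)
        (dif (I.prod 𝓘(ℝ, FU →L[ℝ] ℝ)) G (mu ξ₀))
      obtain ⟨⟨γ, f⟩, hγ⟩ := covec_surjective (I := I) (mu ξ₀)
        (dif (I.prod 𝓘(ℝ, FU →L[ℝ] ℝ)) S.hamiltonian (mu ξ₀))
      rw [S.poisson_comp_mu_funH A hξ (hG _) hσ.symm hγ.symm,
        S.poisson_comp_mu_funH A rfl (hG _) hσ.symm hγ.symm]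
    rw [h1, BivectorField.poisson, dif_comp_mu (hG _)]
    let θ : T →L[ℝ] ℝ := dif (I.prod 𝓘(ℝ, FU →L[ℝ] ℝ)) G (mu ξ₀)
    have h2 : (c.symm θ) ((Module.evalEquiv ℝ T).symm L) = L (c.symm θ) :=
      Module.apply_evalEquiv_symm_apply (R := ℝ) (M := T) (c.symm θ) L
    have h3 : L (c.symm θ) = L' (c (c.symm θ)) := rfl
    rw [c.apply_symm_apply] at h3
    exact h2.trans h3
  choose R hR using key
  exact ⟨R, fun G ξ => hR (mu ξ) G ξ rfl⟩

/-- The defining identity is applied to the smooth function `σ̂ + k ∘ τ`. As such covectors span,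
these values determine the field. -/
theorem IsHamiltonianField.covec_apply {S : AffineSystem I F E FU U} {A : LieAlgebroid I F E}
    {R : ∀ η : CoTotal FU U, TangentSpace (I.prod 𝓘(ℝ, FU →L[ℝ] ℝ)) η}
    (hR : S.IsHamiltonianField A R) {η : CoTotal FU U} {γ : Cₛ^∞⟮I; FU, U⟯}
    {f : C^∞⟮I, Q; 𝓘(ℝ, ℝ), ℝ⟯}
    (hγ : dif (I.prod 𝓘(ℝ, FU →L[ℝ] ℝ)) S.hamiltonian η = covec η (γ, f))
    (σ : Cₛ^∞⟮I; FU, U⟯) (k : C^∞⟮I, Q; 𝓘(ℝ, ℝ), ℝ⟯) :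
    covec η (σ, k) (R η) = S.hamForm A η γ f σ k := by
  obtain ⟨ξ, rfl⟩ := mu_surjective η
  let G : C^∞⟮I.prod 𝓘(ℝ, FU →L[ℝ] ℝ), CoTotal FU U; 𝓘(ℝ, ℝ), ℝ⟯ :=
    ⟨fun η => linFun σ η + k η.1,
      (contMDiff_linFun σ).add (k.contMDiff.comp (contMDiff_proj (CoFiber U)))⟩
  have hG : dif (I.prod 𝓘(ℝ, FU →L[ℝ] ℝ)) G (mu ξ) = covec (mu ξ) (σ, k) :=
    mfderiv_add (mdiff_linFun σ _) (mdiff_base k _)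
  have h := hR G ξ
  rw [S.poisson_comp_mu_funH A rfl (G.contMDiff.mdifferentiable (by simp) _) hG hγ, hG] at h
  exact h

theorem eq_of_covec_eq {η : CoTotal FU U} {v w : TangentSpace (I.prod 𝓘(ℝ, FU →L[ℝ] ℝ)) η}
    (h : ∀ (σ : Cₛ^∞⟮I; FU, U⟯) (k : C^∞⟮I, Q; 𝓘(ℝ, ℝ), ℝ⟯),
      covec η (σ, k) v = covec η (σ, k) w) : v = w := by
  have h1 : ∀ l : EQ × (FU →L[ℝ] ℝ) →L[ℝ] ℝ, l v = l w := fun l => by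
    obtain ⟨⟨σ, k⟩, hσ⟩ := covec_surjective (I := I) η l
    have := h σ k
    rwa [hσ] at this
  exact (SeparatingDual.eq_iff_forall_dual_eq (R := ℝ) (V := EQ × (FU →L[ℝ] ℝ))).2 h1

theorem existsUnique_isHamiltonianField : ∃! R, S.IsHamiltonianField A R := by
  obtain ⟨R, hR⟩ := S.exists_isHamiltonianField A
  refine ⟨R, hR, fun R' hR' => funext fun η => eq_of_covec_eq fun σ k => ?_⟩
  obtain ⟨⟨γ, f⟩, hγ⟩ := covec_surjective (I := I) η
    (dif (I.prod 𝓘(ℝ, FU →L[ℝ] ℝ)) S.hamiltonian η)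
  rw [hR.covec_apply hγ.symm, hR'.covec_apply hγ.symm]

theorem isHamiltonianField_hamiltonianField :
    S.IsHamiltonianField A (S.hamiltonianField A) :=
  Classical.epsilon_spec (S.exists_isHamiltonianField A)

variable (α : Cₛ^∞⟮I; FU →L[ℝ] ℝ, CoFiber U⟯)

/-- The vertical part of `dH` at `α(q)` is `ζ_H^α(q)` by the definition of `ζ_H^α`. The basic
remainder `f` is chosen separately for each `q`. -/
theorem exists_dif_hamiltonian_eq_covec (q : Q) : ∃ f : C^∞⟮I, Q; 𝓘(ℝ, ℝ), ℝ⟯,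
    dif (I.prod 𝓘(ℝ, FU →L[ℝ] ℝ)) S.hamiltonian ⟨q, α q⟩ =
      covec (⟨q, α q⟩ : CoTotal FU U) (S.zeta α, f) := by
  refine exists_eq_covec_of_vertVec fun η => ?_
  have h1 := Classical.choose_spec (S.exists_zeta α) q η
  have h2 := hasDerivAt_vertical (S.mdiff_hamiltonian ⟨q, α q⟩) η
  exact h2.deriv.symm.trans h1.symm

/-- Tested on basic functions, where `σ = 0`, only the anchor term of `hamForm` survives. The
formula exhibits `R_h^α` as smooth although no smoothness of `R_h` is known. -/
theorem baseField_apply (q : Q) :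
    S.baseField A α q = A.anchor q ((S.X₀ + mapSec S.incl (S.zeta α)) q) := by
  refine eq_of_dif_eq fun k => ?_
  obtain ⟨f, hf⟩ := S.exists_dif_hamiltonian_eq_covec α q
  have h1 := (S.isHamiltonianField_hamiltonianField A).covec_apply hf 0 k
  have h2 : mapSec S.incl (0 : Cₛ^∞⟮I; FU, U⟯) = 0 :=
    ContMDiffSection.ext fun q => map_zero (S.incl q)
  have h3 : ∀ f : Q → ℝ, anchorDeriv A.anchor 0 f q = 0 := fun f => by
    simp [anchorDeriv]
  have h4 : α q (S.proj q (A.bracket 0 (S.X₀ + mapSec S.incl (S.zeta α)) q)) = 0 := by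
    rw [A.bracket.map_zero₂]
    exact (congrArg (α q) (map_zero (S.proj q))).trans (map_zero _)
  rw [covec_base, dif_base k _ (S.hamiltonianField A ⟨q, α q⟩), hamForm, h2, h3, h4, neg_zero,
    zero_add, sub_zero] at h1
  have h5 := mfderiv_proj_apply (I := I) (⟨q, α q⟩ : CoTotal FU U)
    (S.hamiltonianField A ⟨q, α q⟩)
  exact (congrArg (dif I k q) h5).trans h1

theorem contMDiff_baseField :
    ContMDiff I I.tangent ∞ (fun q => (⟨q, S.baseField A α q⟩ : TangentBundle I Q)) := by
  have h := (mapSec A.anchor (S.X₀ + mapSec S.incl (S.zeta α))).contMDiff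
  refine h.congr fun q => ?_
  rw [baseField_apply]
  rfl

theorem mdiff_section (q : Q) : MDifferentiableAt I (I.prod 𝓘(ℝ, FU →L[ℝ] ℝ))
    (fun q => (⟨q, α q⟩ : CoTotal FU U)) q :=
  α.contMDiff.mdifferentiable (by simp) q

theorem dif_comp_section {G : CoTotal FU U → ℝ} {q : Q}
    (hG : MDifferentiableAt (I.prod 𝓘(ℝ, FU →L[ℝ] ℝ)) 𝓘(ℝ, ℝ) G ⟨q, α q⟩)
    (v : TangentSpace I q) :
    dif I (fun q => G ⟨q, α q⟩) q v = dif (I.prod 𝓘(ℝ, FU →L[ℝ] ℝ)) G ⟨q, α q⟩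
      (mfderiv I (I.prod 𝓘(ℝ, FU →L[ℝ] ℝ)) (fun q => (⟨q, α q⟩ : CoTotal FU U)) q v) :=
  congrArg (fun L => L v) (mfderiv_comp q hG (mdiff_section α q))

theorem covec_mfderiv_section (q : Q) (v : TangentSpace I q) (σ : Cₛ^∞⟮I; FU, U⟯)
    (k : C^∞⟮I, Q; 𝓘(ℝ, ℝ), ℝ⟯) :
    covec (⟨q, α q⟩ : CoTotal FU U) (σ, k)
        (mfderiv I (I.prod 𝓘(ℝ, FU →L[ℝ] ℝ)) (fun q => (⟨q, α q⟩ : CoTotal FU U)) q v) =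
      dif I (fun q => α q (σ q)) q v + dif I k q v := by
  have h1 := dif_comp_section α (mdiff_linFun σ ⟨q, α q⟩) v
  have h2 := dif_comp_section α (mdiff_base (F := FU) (E := U) k ⟨q, α q⟩) v
  exact (congrArg₂ (· + ·) h1 h2).symm

/-- The form `h ∘ α` takes the value `α(σ)` on `(0, σ)` and `-H ∘ α` on `(1, X₀)`, and their bracket
has no real component, so `H` enters only through its derivative along `ρ(σ)`. Skew-symmetry then
merges the brackets with `ζ_H^α` and with `X₀`. -/
theorem hamiltonJacobi_apply (σ : Cₛ^∞⟮I; FU, U⟯) (q : Q) :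
    S.hamiltonJacobi A α σ q =
      anchorDeriv A.anchor (S.X₀ + mapSec S.incl (S.zeta α)) (fun q => α q (σ q)) q
      - anchorDeriv A.anchor (mapSec S.incl σ) (fun q => α q (S.zeta α q)) q
      + anchorDeriv A.anchor (mapSec S.incl σ) (fun q => S.hamiltonian ⟨q, α q⟩) q
      + α q (S.proj q (A.bracket (mapSec S.incl σ)
        (S.X₀ + mapSec S.incl (S.zeta α)) q)) := by
  have hz : mapSec kerIncl (0 : Cₛ^∞⟮I; FU, U⟯) =
      (0 : Cₛ^∞⟮I; ℝ × FU, Bidual U⟯) :=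
    ContMDiffSection.ext fun q => map_zero (kerIncl (I := I) (FU := FU) q)
  have hz' : mapSec S.incl (0 : Cₛ^∞⟮I; FU, U⟯) = 0 :=
    ContMDiffSection.ext fun q => map_zero (S.incl q)
  have h1 : S.hamiltonJacobi A α σ q =
      (anchorDeriv A.anchor (mapSec S.incl (S.zeta α)) (fun q => α q (σ q)) q
        - anchorDeriv A.anchor (mapSec S.incl σ) (fun q => α q (S.zeta α q)) q
        - α q (S.proj q (A.bracket (mapSec S.incl (S.zeta α)) (mapSec S.incl σ) q)))
      + (anchorDeriv (S.bidualAlgebroid A).anchor oneX₀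
          (fun q => S.hamFib q (α q) (mapSec kerIncl σ q)) q
        - anchorDeriv (S.bidualAlgebroid A).anchor (mapSec kerIncl σ)
          (fun q => S.hamFib q (α q) ((oneX₀ : Cₛ^∞⟮I; ℝ × FU, Bidual U⟯) q)) q
        - S.hamFib q (α q) ((S.bidualAlgebroid A).bracket oneX₀ (mapSec kerIncl σ) q)) := rfl
  have h2 : (fun q => S.hamFib q (α q) (mapSec kerIncl σ q)) = fun q => α q (σ q) := by
    funext q
    have := S.hamFib_apply q (α q) 0 (σ q)
    rw [zero_mul, sub_zero] at this
    exact this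
  have h3 : (fun q => S.hamFib q (α q) ((oneX₀ : Cₛ^∞⟮I; ℝ × FU, Bidual U⟯) q)) =
      fun q => -S.hamiltonian ⟨q, α q⟩ := by
    funext q
    have := S.hamFib_apply q (α q) 1 0
    rw [map_zero, one_mul, zero_sub] at this
    exact this
  have h4 : anchorDeriv (S.bidualAlgebroid A).anchor oneX₀ (fun q => α q (σ q)) q =
      anchorDeriv A.anchor S.X₀ (fun q => α q (σ q)) q := by
    have := S.bidual_anchorDeriv_oneX₀_add A 0 (fun q => α q (σ q)) q
    rwa [hz, hz', add_zero, add_zero] at this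
  have h5 : anchorDeriv A.anchor (mapSec S.incl σ) (fun q => -S.hamiltonian ⟨q, α q⟩) q =
      -anchorDeriv A.anchor (mapSec S.incl σ) (fun q => S.hamiltonian ⟨q, α q⟩) q := by
    have h : dif I (fun q => -S.hamiltonian ⟨q, α q⟩) q =
      -dif I (fun q => S.hamiltonian ⟨q, α q⟩) q := mfderiv_neg
    rw [anchorDeriv, h]
    rfl
  have h6 : S.hamFib q (α q) ((S.bidualAlgebroid A).bracket oneX₀ (mapSec kerIncl σ) q) =
      -α q (S.proj q (A.bracket (mapSec S.incl σ) S.X₀ q)) := by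
    have h7 := S.bidual_bracket A σ 0
    rw [hz, hz', add_zero, add_zero] at h7
    rw [(S.bidualAlgebroid A).skew, h7]
    have h8 := S.hamFib_apply q (α q) 0 (S.proj q (A.bracket (mapSec S.incl σ) S.X₀ q))
    rw [zero_mul, sub_zero] at h8
    exact (map_neg (S.hamFib q (α q)) _).trans (congrArg Neg.neg h8)
  have h7 : α q (S.proj q (A.bracket (mapSec S.incl (S.zeta α)) (mapSec S.incl σ) q)) =
      -α q (S.proj q (A.bracket (mapSec S.incl σ) (mapSec S.incl (S.zeta α)) q)) := by
    rw [A.skew]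
    exact (congrArg (α q) (map_neg (S.proj q) _)).trans (map_neg _ _)
  have h8 : α q (S.proj q (A.bracket (mapSec S.incl σ)
      (S.X₀ + mapSec S.incl (S.zeta α)) q)) =
      α q (S.proj q (A.bracket (mapSec S.incl σ) S.X₀ q)) +
        α q (S.proj q (A.bracket (mapSec S.incl σ) (mapSec S.incl (S.zeta α)) q)) := by
    rw [map_add]
    exact (congrArg (α q) (map_add (S.proj q) _ _)).trans (map_add _ _ _)
  rw [h1, h2, h3, h4, bidual_anchorDeriv_kerIncl, h5, h6, h7, h8, anchorDeriv_add_left]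
  ring

/-- `R_h^α` and `R_h` are `α`-related at `q` if and only if the Hamilton-Jacobi equation holds
at `q`. -/
theorem mfderiv_section_baseField_eq_iff (q : Q) :
    mfderiv I (I.prod 𝓘(ℝ, FU →L[ℝ] ℝ)) (fun q => (⟨q, α q⟩ : CoTotal FU U)) q
        (S.baseField A α q) = S.hamiltonianField A ⟨q, α q⟩ ↔
      ∀ σ, S.hamiltonJacobi A α σ q = 0 := by
  obtain ⟨f, hf⟩ := S.exists_dif_hamiltonian_eq_covec α q
  have hR := (S.isHamiltonianField_hamiltonianField A).covec_apply hf
  -- Differentiating `H ∘ α` at `q` through `dH = d ζ̂ + d(f ∘ τ)` allows the auxiliary `f` to be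
  -- eliminated.
  have hH : ∀ σ, anchorDeriv A.anchor (mapSec S.incl σ) (fun q => S.hamiltonian ⟨q, α q⟩) q =
      anchorDeriv A.anchor (mapSec S.incl σ) (fun q => α q (S.zeta α q)) q
        + anchorDeriv A.anchor (mapSec S.incl σ) f q := fun σ => by
    rw [anchorDeriv, dif_comp_section α (S.mdiff_hamiltonian ⟨q, α q⟩), hf,
      covec_mfderiv_section]
    rfl
  -- No `k` on the right: both vectors project to `R_h^α(q)`, so basic functions do not distinguish
  -- them.
  have key : ∀ σ k, covec (⟨q, α q⟩ : CoTotal FU U) (σ, k)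
      (mfderiv I (I.prod 𝓘(ℝ, FU →L[ℝ] ℝ)) (fun q => (⟨q, α q⟩ : CoTotal FU U)) q
        (S.baseField A α q)) - covec (⟨q, α q⟩ : CoTotal FU U) (σ, k)
      (S.hamiltonianField A ⟨q, α q⟩) = S.hamiltonJacobi A α σ q := fun σ k => by
    rw [hR σ k, covec_mfderiv_section, hamiltonJacobi_apply, hH, hamForm, baseField_apply]
    simp only [anchorDeriv]
    ring
  constructor
  · intro h σ
    rw [← key σ 0, h, sub_self]
  · intro h
    exact eq_of_covec_eq fun σ k => sub_eq_zero.1 ((key σ k).trans (h σ))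

end AffineSystem

end MechanicalSystem

end AffineHJ

end

/-! ### Integral curves and the equivalence -/

theorem corollary4p6
    -- the manifold `Q`, of finite dimension and without boundary
    {EQ : Type*} [NormedAddCommGroup EQ] [NormedSpace ℝ EQ] [FiniteDimensional ℝ EQ]
    {HQ : Type*} [TopologicalSpace HQ] (I : ModelWithCorners ℝ EQ HQ) [I.Boundaryless]
    {Q : Type*} [TopologicalSpace Q] [T2Space Q] [ChartedSpace HQ Q] [IsManifold I ∞ Q]
    -- the vector bundle `E → Q`, of finite rank
    {F : Type*} [NormedAddCommGroup F] [NormedSpace ℝ F] [FiniteDimensional ℝ F]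
    {E : Q → Type*} [TopologicalSpace (TotalSpace F E)] [∀ q, TopologicalSpace (E q)]
    [∀ q, AddCommGroup (E q)] [∀ q, Module ℝ (E q)] [FiberBundle F E] [VectorBundle ℝ F E]
    [ContMDiffVectorBundle ∞ F E I]
    [∀ q, IsTopologicalAddGroup (E q)] [∀ q, ContinuousSMul ℝ (E q)]
    -- the vector bundle `U → Q`, of finite rank
    {FU : Type*} [NormedAddCommGroup FU] [NormedSpace ℝ FU] [FiniteDimensional ℝ FU]
    {U : Q → Type*} [TopologicalSpace (TotalSpace FU U)] [∀ q, TopologicalSpace (U q)]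
    [∀ q, AddCommGroup (U q)] [∀ q, Module ℝ (U q)] [FiberBundle FU U] [VectorBundle ℝ FU U]
    [ContMDiffVectorBundle ∞ FU U I]
    [∀ q, IsTopologicalAddGroup (U q)] [∀ q, ContinuousSMul ℝ (U q)]
    -- the Lie algebroid `E`, the affine nonholonomic system, and the section `α` of `U*`
    (A : AffineHJ.LieAlgebroid I F E) (S : AffineHJ.AffineSystem I F E FU U)
    (α : Cₛ^∞⟮I; FU →L[ℝ] ℝ, AffineHJ.CoFiber U⟯) :
    -- the bracket on `𝒰⁺` and the Hamiltonian vector field `R_h` on `U*` are well defined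
    (∃! B : AffineHJ.BivectorField I (ℝ × FU) (AffineHJ.Bidual U),
      (S.bidualAlgebroid A).IsLinearPoisson B) ∧
    (∃! R : ∀ η : AffineHJ.CoTotal FU U, TangentSpace (I.prod 𝓘(ℝ, FU →L[ℝ] ℝ)) η,
      S.IsHamiltonianField A R) ∧
    -- the equivalence
    ((∀ (J : Set ℝ), IsOpen J → J.OrdConnected → ∀ c : ℝ → Q,
        IsMIntegralCurveOn c (S.baseField A α) J →
        IsMIntegralCurveOn (fun t => (⟨c t, α (c t)⟩ : AffineHJ.CoTotal FU U))
          (S.hamiltonianField A) J) ↔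
      S.hamiltonJacobi A α = 0) := by
  refine ⟨(S.bidualAlgebroid A).existsUnique_isLinearPoisson,
    S.existsUnique_isHamiltonianField A, ?_⟩
  have hJ : S.hamiltonJacobi A α = 0 ↔ ∀ q, mfderiv I (I.prod 𝓘(ℝ, FU →L[ℝ] ℝ))
      (fun q => (⟨q, α q⟩ : AffineHJ.CoTotal FU U)) q (S.baseField A α q) =
        S.hamiltonianField A ⟨q, α q⟩ := by
    simp only [S.mfderiv_section_baseField_eq_iff A α]
    exact ⟨fun h q σ => congrFun (congrFun h σ) q, fun h => funext fun σ => funext fun q => h q σ⟩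
  rw [hJ]
  constructor
  · intro h q
    have : CompleteSpace EQ := FiniteDimensional.complete ℝ EQ
    have : IsManifold I 1 Q := IsManifold.of_le (n := ∞) (by simp)
    -- An integral curve of the smooth field `R_h^α` through `q`. By (i), its lift has velocity
    -- `R_h(α(q))` at time `0`, while the chain rule gives `Tα(R_h^α(q))`.
    obtain ⟨c, hc0, hc⟩ := exists_isMIntegralCurveAt_of_contMDiffAt_boundaryless 0
      (((S.contMDiff_baseField A α).of_le (by simp)) q)
    obtain ⟨ε, hε, hc⟩ := isMIntegralCurveAt_iff'.1 hc
    have h0 : (0 : ℝ) ∈ Metric.ball (0 : ℝ) ε := Metric.mem_ball_self hε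
    have hnhds := Metric.ball_mem_nhds (0 : ℝ) hε
    have h1 := (h _ Metric.isOpen_ball (convex_ball 0 ε).ordConnected c hc 0 h0).hasMFDerivAt hnhds
    have h2 := (AffineHJ.AffineSystem.mdiff_section α (c 0)).hasMFDerivAt.comp (0 : ℝ)
      ((hc 0 h0).hasMFDerivAt hnhds)
    have h3 := congrArg (fun L => L (1 : ℝ)) (hasMFDerivAt_unique h2 h1)
    subst hc0
    have h4 := (one_smul ℝ (S.hamiltonianField A ⟨c 0, α (c 0)⟩)).symm
    refine Eq.trans ?_ (h3.trans h4.symm)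
    exact congrArg (mfderiv I (I.prod 𝓘(ℝ, FU →L[ℝ] ℝ))
      (fun q => (⟨q, α q⟩ : AffineHJ.CoTotal FU U)) (c 0)) (one_smul ℝ _).symm
  · intro h J hJo _ c hc t ht
    -- The chain rule gives the lift the velocity `Tα(R_h^α(c t))`, which is `R_h` at `α(c t)` by
    -- the pointwise relation; no regularity of `R_h` enters.
    have h2 := (AffineHJ.AffineSystem.mdiff_section α (c t)).hasMFDerivAt.comp_hasMFDerivWithinAt t
      (hc t ht)
    refine h2.congr_mfderiv ?_
    rw [← h (c t)]
    ext
    exact map_smul (mfderiv I (I.prod 𝓘(ℝ, FU →L[ℝ] ℝ))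
      (fun q => (⟨q, α q⟩ : AffineHJ.CoTotal FU U)) (c t)) (1 : ℝ) _
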